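/- **Notation.** $\|\cdot\|_2$ is the spectral norm, $M^\dagger$ the Moore–Penrose pseudo-inverse, and $\kappa_2(M)=\|M\|_2\|M^\dagger\|_2$ for a matrix $M$ with linearly independent columns. For $u>0$ (the unit round-off) and an integer $k$ with $ku<1$ put $\gamma_k=ku/(1-ku)$. Floating-point arithmetic follows the standard model: every elementary operation ($+,-,\times,/,\sqrt{\cdot}$) with exact result $x$ returns some value $x(1+\delta)$ with $|\delta|\le u$; sums may be accumulated in any order. **Theorem.** There is a universal integer constant $c\ge 1$ such that, with $\tilde\gamma_{sn}=\gamma_{csn}$, the following holds. Let $m>s>n$ and $u>0$ with $mu<1$ and $csnu<1$. Let $A\in\mathbb{R}^{m\times n}$ have linearly independent columns, let $S\in\mathbb{R}^{s\times m}$ have linearly independent rows, and suppose that $SA$ has full column rank. Let $A=Q_AR_A$ be an economized QR factorization ($Q_A\in\mathbb{R}^{m\times n}$ with orthonormal columns, $R_A\in\mathbb{R}^{n\times n}$ upper triangular), and put $$C_1=\sqrt{sn}\,\gamma_m+\sqrt n\,\tilde\gamma_{sn}\,(1+\sqrt{sn}\,\gamma_m),\qquad k(S)=\|S\|_2\,\|(SQ_A)^\dagger\|_2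 .$$ Assume that $$\kappa_2(SQ_A)<49,\qquad n^2u<\tfrac1{201},\qquad \tfrac mn+\sqrt n>200,\qquad \kappa_2(A)<\frac{1}{3\,C_1\,k(S)} .$$ In floating-point arithmetic, compute the product $\hat B$ of $S$ and $A$ by the standard algorithm; then the triangular factor $\hat R\in\mathbb{R}^{n\times n}$ of $\hat B$ by Householder QR (reflectors $I-\beta vv^T$ with $v=x+\tau e_1$, $\tau=\operatorname{sign}(x_1)\|x\|_2$, $\beta=1/(\tau v_1)$); then $\hat Y\in\mathbb{R}^{m\times n}$, the computed $A\hat R^{-1}$, by solving $\hat R^Ty_i=a_i$ with forward substitution for every row $a_i^T$ of $A$. Then, whatever the rounding errors, $\hat R$ has non-zero diagonal entries (so that the substitution does not break down), $\hat Y$ has linearly independent columns, and $$\kappa_2(\hat Y)\le 4\,\kappa_2(SQ_A)+1 .$$ Moreover, under these assumptions, $C_1\le K\,(\sqrt{sn}\,m+sn^{3/2})\,u$ with a universal constant $K$. -/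

import Mathlib

open Matrix

namespace SketchApply

noncomputable section

/-! ### Spectral norm, pseudo-inverse, condition number -/

open scoped Matrix.Norms.L2Operator in
/-- The spectral norm `‖M‖₂`, the operator norm between Euclidean spaces. -/
def specNorm {m n : ℕ} (M : Matrix (Fin m) (Fin n) ℝ) : ℝ := ‖M‖

/-- The Moore–Penrose pseudo-inverse `M† = (MᵀM)⁻¹Mᵀ` of a matrix with linearly
independent columns. -/
def pinv {m n : ℕ} (M : Matrix (Fin m) (Fin n) ℝ) : Matrix (Fin n) (Fin m) ℝ :=
  (Mᵀ * M)⁻¹ * Mᵀ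

/-- The condition number `κ₂(M) = ‖M‖₂ ‖M†‖₂` of a matrix with linearly independent columns. -/
def cond2 {m n : ℕ} (M : Matrix (Fin m) (Fin n) ℝ) : ℝ := specNorm M * specNorm (pinv M)

/-! ### Error constants -/

/-- `γ_k = k u / (1 - k u)`; it is used only when `k u < 1`. -/
def gam (u : ℝ) (k : ℕ) : ℝ := k * u / (1 - k * u)

/-- `C₁ = √(sn) γ_m + √n γ̃_{sn} (1 + √(sn) γ_m)`, with `γ̃_{sn} = γ_{c s n}`. -/
def C1 (c : ℕ) (u : ℝ) (m s n : ℕ) : ℝ :=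
  √((s : ℝ) * n) * gam u m
    + √(n : ℝ) * gam u (c * s * n) * (1 + √((s : ℝ) * n) * gam u m)

/-- `k(S) = ‖S‖₂ ‖(S Q_A)†‖₂`. -/
def kS {m s n : ℕ} (S : Matrix (Fin s) (Fin m) ℝ) (QA : Matrix (Fin m) (Fin n) ℝ) : ℝ :=
  specNorm S * specNorm (pinv (S * QA))

/-! ### Floating-point arithmetic -/

/-- The standard model of floating-point arithmetic: `y` is a possible computed value of an
elementary operation (`+`, `-`, `*`, `/`, `√`) whose exact result is `x`. -/
def IsFl (u x y : ℝ) : Prop := ∃ δ : ℝ, |δ| ≤ u ∧ y = x * (1 + δ)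

/-- `FlSum u f I r`: `r` is a possible computed value of the nonempty sum `∑ i ∈ I, f i`. Each of
the `|I| - 1` additions is rounded; the order of evaluation is arbitrary. -/
inductive FlSum {ι : Type} [DecidableEq ι] (u : ℝ) (f : ι → ℝ) : Finset ι → ℝ → Prop
  | single (i : ι) : FlSum u f {i} (f i)
  | add (I J : Finset ι) (a b r : ℝ) (hIJ : Disjoint I J)
      (ha : FlSum u f I a) (hb : FlSum u f J b) (hr : IsFl u (a + b) r) : FlSum u f (I ∪ J) r

/-- `r` is a possible computed value of the inner product `∑ i ∈ I, x i * y i`. -/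
def FlDot {ι : Type} [DecidableEq ι] (u : ℝ) (I : Finset ι) (x y : ι → ℝ) (r : ℝ) : Prop :=
  ∃ p : ι → ℝ, (∀ i ∈ I, IsFl u (x i * y i) (p i)) ∧ FlSum u p I r

/-- `r` is a possible computed value of the Euclidean norm `√(∑ i ∈ I, x i ^ 2)`. -/
def FlNorm {ι : Type} [DecidableEq ι] (u : ℝ) (I : Finset ι) (x : ι → ℝ) (r : ℝ) : Prop :=
  ∃ q : ℝ, FlDot u I x x q ∧ IsFl u (√q) r

/-- `P` is a possible computed value of the matrix product `M * N` by the standard algorithm. -/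
def FlMul {s m n : ℕ} (u : ℝ) (M : Matrix (Fin s) (Fin m) ℝ) (N : Matrix (Fin m) (Fin n) ℝ)
    (P : Matrix (Fin s) (Fin n) ℝ) : Prop :=
  ∀ i j, FlDot u Finset.univ (fun l => M i l) (fun l => N l j) (P i j)

/-- `HouseholderStep u p k W W'`: one step of Householder QR in floating point, which eliminates
column `k` of `W` below the pivot row `p` and yields `W'`. With `x` the part of column `k` in the
rows `≥ p`, the step computes
`σ = ‖x‖₂`, `τ = sign(x_p) σ`, `v = x + τ e_p`, `β = 1 / (τ v_p)`,
replaces `x` by `-τ e_p`, and replaces the part `b` of every column `j > k` in the rows `≥ p` by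
`b - (β (vᵀ b)) v`. If `σ = 0`, nothing is done. -/
def HouseholderStep {s n : ℕ} (u : ℝ) (p : Fin s) (k : Fin n)
    (W W' : Matrix (Fin s) (Fin n) ℝ) : Prop :=
  ∃ σ : ℝ, FlNorm u (Finset.Ici p) (fun i => W i k) σ ∧
    ((σ = 0 ∧ W' = W) ∨
      (σ ≠ 0 ∧ ∃ (τ d β : ℝ) (v : Fin s → ℝ),
        τ = (if W p k < 0 then -σ else σ) ∧
        IsFl u (W p k + τ) (v p) ∧
        (∀ i, p < i → v i = W i k) ∧
        IsFl u (τ * v p) d ∧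
        IsFl u (1 / d) β ∧
        (∀ i j, i < p ∨ j < k → W' i j = W i j) ∧
        W' p k = -τ ∧
        (∀ i, p < i → W' i k = 0) ∧
        ∀ j, k < j → ∃ w t : ℝ,
          FlDot u (Finset.Ici p) v (fun i => W i j) w ∧
          IsFl u (β * w) t ∧
          ∀ i, p ≤ i → ∃ q : ℝ, IsFl u (t * v i) q ∧ IsFl u (W i j - q) (W' i j)))

/-- `R` is a possible computed triangular factor of Householder QR applied to `B`. -/
def FlHouseholderR {s n : ℕ} (u : ℝ) (hns : n ≤ s) (B : Matrix (Fin s) (Fin n) ℝ)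
    (R : Matrix (Fin n) (Fin n) ℝ) : Prop :=
  ∃ W : ℕ → Matrix (Fin s) (Fin n) ℝ,
    W 0 = B ∧
    (∀ k : Fin n, HouseholderStep u (Fin.castLE hns k) k (W k) (W (k + 1))) ∧
    ∀ i j, R i j = W n (Fin.castLE hns i) j

/-- `y` is a possible computed solution of `Rᵀ y = a`, `R` upper triangular, by forward
substitution `y_i = (a_i - ∑_{j < i} R_{ji} y_j) / R_{ii}`. -/
def FlForwardSubst {n : ℕ} (u : ℝ) (R : Matrix (Fin n) (Fin n) ℝ) (a y : Fin n → ℝ) : Prop :=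
  ∀ i, ∃ (p : Fin n → ℝ) (t : ℝ),
    (∀ j, j < i → IsFl u (R j i * y j) (p j)) ∧
    FlSum u (fun j => if j = i then a i else -p j) (Finset.Iic i) t ∧
    IsFl u (t / R i i) (y i)

/-- `Y` is a possible computed value of `A R⁻¹`: row `i` of `Y` is obtained from row `i` of `A` by
forward substitution with `Rᵀ`. -/
def FlRightSolve {m n : ℕ} (u : ℝ) (A : Matrix (Fin m) (Fin n) ℝ) (R : Matrix (Fin n) (Fin n) ℝ)
    (Y : Matrix (Fin m) (Fin n) ℝ) : Prop :=
  ∀ i, FlForwardSubst u R (A i) (Y i)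

end

end SketchApply

namespace SketchApply

/-! Write `g = ‖(S Q_A)†‖` and `κ = κ₂(S Q_A)`. Since `S A = (S Q_A) R_A` and `‖R_A x‖ = ‖A x‖`, the
quantity `g ‖S A x‖` lies between `‖A x‖` and `κ ‖A x‖`. Computing `B` and its triangular factor
changes `‖S A x‖` by at most `C₁ ‖S‖ ‖A‖ ‖x‖` (`abs_en_triangular_sub_le`). As `‖x‖ ≤ ‖A†‖ ‖A x‖`,
the bound on `κ₂(A)` makes this at most `‖A x‖ / (3 g)`. So `g ‖R x‖ / ‖A x‖` stays between `2/3`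
and `κ + 1/3` (`triangular_factor_bounds`): `R` is nonsingular and the exact `A R⁻¹` is well
conditioned.

Forward substitution leaves a residual `A - Y R` of norm at most `n γ_{2n} ‖Y‖ ‖R‖`
(`FlRightSolve.specNorm_residual_le`). With `c` large, `n γ_{2n} ≤ C₁ / 1000`, so the same
assumption bounds `‖A x - Y R x‖` by `‖Y‖ ‖R x‖ / 1000`, and `Y` inherits the conditioning of `A
R⁻¹` (`cond2_approx_solution_le`).

The error analysis is by relative factors (`RelErr`). Each Householder step is close to the exact
reflector of the current computed matrix (`HouseholderStep.exists_isometry`); these isometries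
compose without amplifying errors. -/

/-! ### Accumulated relative errors -/

/-- `ρ` is bounded like a product of `k` factors `(1 + δ)` or `1 / (1 + δ)` with `|δ| ≤ u`. -/
def RelErr (u : ℝ) (k : ℕ) (ρ : ℝ) : Prop := (1 - u) ^ k ≤ ρ ∧ ρ * (1 - u) ^ k ≤ 1

section RelErr

variable {u : ℝ}

theorem RelErr.pos (hu : u < 1) {k : ℕ} {ρ : ℝ} (h : RelErr u k ρ) : 0 < ρ :=
  (pow_pos (by linarith) k).trans_le h.1

theorem RelErr.one (hu0 : 0 ≤ u) (hu : u < 1) (k : ℕ) : RelErr u k 1 := by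
  have h : (1 - u) ^ k ≤ 1 := pow_le_one₀ (by linarith) (by linarith)
  exact ⟨h, by simpa using h⟩

theorem RelErr.mono (hu0 : 0 ≤ u) (hu : u < 1) {k l : ℕ} (hkl : k ≤ l) {ρ : ℝ}
    (h : RelErr u k ρ) : RelErr u l ρ := by
  have hp : (1 - u) ^ l ≤ (1 - u) ^ k :=
    pow_le_pow_of_le_one (by linarith) (by linarith) hkl
  exact ⟨hp.trans h.1, (mul_le_mul_of_nonneg_left hp (h.pos hu).le).trans h.2⟩

theorem RelErr.mul (hu : u < 1) {k l : ℕ} {ρ ρ' : ℝ} (h : RelErr u k ρ)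
    (h' : RelErr u l ρ') : RelErr u (k + l) (ρ * ρ') := by
  have h1 : 0 < 1 - u := by linarith
  constructor
  · rw [pow_add]
    exact mul_le_mul h.1 h'.1 (by positivity) (h.pos hu).le
  · have := mul_le_mul h.2 h'.2 (mul_nonneg (h'.pos hu).le (by positivity)) zero_le_one
    calc ρ * ρ' * (1 - u) ^ (k + l) = ρ * (1 - u) ^ k * (ρ' * (1 - u) ^ l) := by ring
      _ ≤ 1 := by linarith

/-- Inversion swaps the two inequalities of `RelErr`. This symmetry is what the two-sided form buys:
moving a factor across an equation costs nothing. -/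
theorem RelErr.inv (hu : u < 1) {k : ℕ} {ρ : ℝ} (h : RelErr u k ρ) : RelErr u k ρ⁻¹ := by
  have hρ := h.pos hu
  constructor
  · rw [le_inv_comm₀ (pow_pos (by linarith) k) hρ, ← one_div, le_div_iff₀ (pow_pos (by linarith) k)]
    exact h.2
  · rw [inv_mul_le_iff₀ hρ]
    simpa using h.1

theorem RelErr.one_add (hu : u < 1) {δ : ℝ} (hδ : |δ| ≤ u) : RelErr u 1 (1 + δ) := by
  have := abs_le.1 hδ
  constructor
  · simp; linarith
  · nlinarith [mul_self_nonneg u]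

theorem RelErr.sqrt (hu0 : 0 ≤ u) (hu : u < 1) {k : ℕ} {ρ : ℝ} (h : RelErr u k ρ) :
    RelErr u k (√ρ) := by
  have h1 : 0 < 1 - u := by linarith
  have hp : (1 - u) ^ k ≤ 1 := pow_le_one₀ (by linarith) (by linarith)
  have hp0 : 0 < (1 - u) ^ k := by positivity
  constructor
  · apply Real.le_sqrt_of_sq_le
    nlinarith [h.1]
  · have hs := Real.sq_sqrt (h.pos hu).le
    have : (√ρ * (1 - u) ^ k) ^ 2 ≤ 1 := by
      rw [mul_pow, hs]
      nlinarith [h.2, h.pos hu]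
    nlinarith

theorem RelErr.exists_of_isFl (hu : u < 1) {x y : ℝ} (h : IsFl u x y) :
    ∃ ρ, RelErr u 1 ρ ∧ y = x * ρ := by
  obtain ⟨δ, hδ, rfl⟩ := h
  exact ⟨1 + δ, .one_add hu hδ, rfl⟩

/-- Bernoulli: `(1 - u)^k ≥ 1 - k u`. This turns factor counts into `γ_k`. -/
theorem RelErr.abs_sub_one_le (hu : u < 1) {k : ℕ} (hk : k * u < 1) {ρ : ℝ}
    (h : RelErr u k ρ) : |ρ - 1| ≤ gam u k := by
  have hb : 1 - k * u ≤ (1 - u) ^ k := by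
    have := one_add_mul_le_pow (a := -u) (by linarith) k
    simpa [sub_eq_add_neg] using this
  have hpos : 0 < 1 - k * u := by linarith
  have hρ := h.pos hu
  unfold gam
  rw [abs_le]
  constructor
  · rw [neg_le, le_div_iff₀ hpos]
    by_cases h1 : 1 ≤ ρ
    · have hp := h.2
      have : (1 - u) ^ k ≤ 1 := by nlinarith [pow_pos (show 0 < 1 - u by linarith) k]
      nlinarith [h.1]
    · nlinarith [h.1]
  · rw [le_div_iff₀ hpos]
    nlinarith [h.2]

/-- A sum of nonnegative terms with relative errors has a small relative error. -/
theorem RelErr.sum_nonneg (hu0 : 0 ≤ u) (hu : u < 1) {ι : Type*} {k : ℕ} (I : Finset ι)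
    {a ρ : ι → ℝ} (ha : ∀ i ∈ I, 0 ≤ a i) (hρ : ∀ i ∈ I, RelErr u k (ρ i)) :
    ∃ r, RelErr u k r ∧ ∑ i ∈ I, a i * ρ i = (∑ i ∈ I, a i) * r := by
  rcases (Finset.sum_nonneg ha).eq_or_lt with h0 | hpos
  · refine ⟨1, .one hu0 hu k, ?_⟩
    rw [← h0, zero_mul]
    refine Finset.sum_eq_zero fun i hi => ?_
    rw [(Finset.sum_eq_zero_iff_of_nonneg ha).1 h0.symm i hi, zero_mul]
  · refine ⟨(∑ i ∈ I, a i * ρ i) / ∑ i ∈ I, a i, ⟨?_, ?_⟩, by field_simp⟩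
    · rw [le_div_iff₀ hpos, Finset.mul_sum]
      exact Finset.sum_le_sum fun i hi => by nlinarith [ha i hi, (hρ i hi).1]
    · rw [div_mul_eq_mul_div, div_le_one hpos, Finset.sum_mul]
      exact Finset.sum_le_sum fun i hi => by nlinarith [ha i hi, (hρ i hi).2]

/-- A sum of two terms of the same sign with relative errors has a small relative error. -/
theorem RelErr.add_same_sign (hu0 : 0 ≤ u) (hu : u < 1) {k : ℕ} {a b ρ ρ' : ℝ}
    (hab : (0 ≤ a ∧ 0 ≤ b) ∨ (a ≤ 0 ∧ b ≤ 0)) (hρ : RelErr u k ρ) (hρ' : RelErr u k ρ') :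
    ∃ r, RelErr u k r ∧ a * ρ + b * ρ' = (a + b) * r := by
  rcases hab with ⟨ha, hb⟩ | ⟨ha, hb⟩
  · simpa using RelErr.sum_nonneg hu0 hu (Finset.univ : Finset (Fin 2)) (a := ![a, b])
      (ρ := ![ρ, ρ']) (k := k) (by simp [ha, hb]) (by simp [hρ, hρ'])
  · obtain ⟨r, hr, h⟩ := RelErr.sum_nonneg hu0 hu (Finset.univ : Finset (Fin 2)) (a := ![-a, -b])
      (ρ := ![ρ, ρ']) (k := k) (by simp [ha, hb]) (by simp [hρ, hρ'])
    simp only [Fin.sum_univ_two, Matrix.cons_val_zero, Matrix.cons_val_one] at h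
    exact ⟨r, hr, by linarith⟩

/-! ### Rounding errors of sums, inner products and norms. -/

variable {ι : Type} [DecidableEq ι]

theorem FlSum.nonempty {f : ι → ℝ} {I : Finset ι} {r : ℝ} (h : FlSum u f I r) : I.Nonempty := by
  induction h with
  | single i => simp
  | add I J a b r hIJ ha hb hr iha ihb => exact iha.mono Finset.subset_union_left

/-- In any order, a term takes part in at most `|I| - 1` additions; in the induction, nonemptiness
of both parts pays for the new one. -/
theorem FlSum.exists_relErr (hu0 : 0 ≤ u) (hu : u < 1) {f : ι → ℝ} {I : Finset ι} {r : ℝ}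
    (h : FlSum u f I r) :
    ∃ ρ : ι → ℝ, (∀ i, RelErr u (I.card - 1) (ρ i)) ∧ r = ∑ i ∈ I, f i * ρ i := by
  induction h with
  | single i => exact ⟨1, fun _ => .one hu0 hu _, by simp⟩
  | add I J a b r hIJ ha hb hr iha ihb =>
    obtain ⟨ρ, hρ, rfl⟩ := iha
    obtain ⟨ρ', hρ', rfl⟩ := ihb
    obtain ⟨μ, hμ, rfl⟩ := RelErr.exists_of_isFl hu hr
    have hI := ha.nonempty.card_pos
    have hJ := hb.nonempty.card_pos
    have hc := Finset.card_union_of_disjoint hIJ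
    refine ⟨fun i => (if i ∈ I then ρ i else ρ' i) * μ, fun i => ?_, ?_⟩
    · dsimp only
      split_ifs
      · exact ((hρ i).mul hu hμ).mono hu0 hu (by omega)
      · exact ((hρ' i).mul hu hμ).mono hu0 hu (by omega)
    · rw [Finset.sum_union hIJ, add_mul, Finset.sum_mul, Finset.sum_mul]
      congr 1
      · exact Finset.sum_congr rfl fun i hi => by simp [hi, mul_assoc]
      · exact Finset.sum_congr rfl fun i hi => by
          simp [Finset.disjoint_right.1 hIJ hi, mul_assoc]

theorem FlDot.exists_relErr (hu0 : 0 ≤ u) (hu : u < 1) {x y : ι → ℝ} {I : Finset ι} {r : ℝ}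
    (h : FlDot u I x y r) :
    ∃ ρ : ι → ℝ, (∀ i ∈ I, RelErr u I.card (ρ i)) ∧ r = ∑ i ∈ I, x i * y i * ρ i := by
  obtain ⟨p, hp, hs⟩ := h
  have hI := hs.nonempty.card_pos
  obtain ⟨ρ, hρ, rfl⟩ := hs.exists_relErr hu0 hu
  have hp' : ∀ i, ∃ μ, i ∈ I → RelErr u 1 μ ∧ p i = x i * y i * μ := fun i => by
    by_cases hi : i ∈ I
    · obtain ⟨μ, h⟩ := RelErr.exists_of_isFl hu (hp i hi)
      exact ⟨μ, fun _ => h⟩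
    · exact ⟨0, fun h => absurd h hi⟩
  choose μ hμ using hp'
  refine ⟨fun i => μ i * ρ i, fun i hi => ?_, Finset.sum_congr rfl fun i hi => ?_⟩
  · exact ((hμ i hi).1.mul hu (hρ i)).mono hu0 hu (by omega)
  · rw [(hμ i hi).2]; ring

/-- Squares do not cancel, so the errors merge into one factor of the whole sum. -/
theorem FlNorm.exists_relErr (hu0 : 0 ≤ u) (hu : u < 1) {x : ι → ℝ} {I : Finset ι} {r : ℝ}
    (h : FlNorm u I x r) :
    ∃ ρ, RelErr u (I.card + 1) ρ ∧ r = √(∑ i ∈ I, x i ^ 2) * ρ := by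
  obtain ⟨q, hq, hr⟩ := h
  obtain ⟨ρ, hρ, rfl⟩ := hq.exists_relErr hu0 hu
  obtain ⟨μ, hμ, h⟩ := RelErr.sum_nonneg hu0 hu I (a := fun i => x i * x i)
    (fun i _ => mul_self_nonneg _) hρ
  obtain ⟨ν, hν, rfl⟩ := RelErr.exists_of_isFl hu hr
  refine ⟨√μ * ν, (hμ.sqrt hu0 hu).mul hu hν, ?_⟩
  rw [h, Real.sqrt_mul (Finset.sum_nonneg fun i _ => mul_self_nonneg _)]
  simp only [pow_two]
  ring

theorem abs_sum_mul_relErr_sub_le (hu : u < 1) {k : ℕ} (hk : k * u < 1) {ι : Type*}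
    (I : Finset ι) {a ρ : ι → ℝ} (hρ : ∀ i ∈ I, RelErr u k (ρ i)) :
    |∑ i ∈ I, a i * ρ i - ∑ i ∈ I, a i| ≤ gam u k * ∑ i ∈ I, |a i| := by
  rw [← Finset.sum_sub_distrib, Finset.mul_sum]
  refine (Finset.abs_sum_le_sum_abs _ _).trans (Finset.sum_le_sum fun i hi => ?_)
  rw [show a i * ρ i - a i = (ρ i - 1) * a i by ring, abs_mul]
  exact mul_le_mul_of_nonneg_right ((hρ i hi).abs_sub_one_le hu hk) (abs_nonneg _)

end RelErr

theorem gam_nonneg {u : ℝ} (hu : 0 ≤ u) {k : ℕ} (hk : k * u < 1) : 0 ≤ gam u k :=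
  div_nonneg (by positivity) (by linarith)

/-! ### Euclidean norm of coordinate vectors -/

/-- The Euclidean norm of a coordinate vector. -/
noncomputable def en {ι : Type*} [Fintype ι] (x : ι → ℝ) : ℝ := ‖WithLp.toLp 2 x‖

section en

variable {ι : Type*} [Fintype ι]

theorem en_nonneg (x : ι → ℝ) : 0 ≤ en x := norm_nonneg _

theorem en_sq (x : ι → ℝ) : en x ^ 2 = ∑ i, x i ^ 2 := by
  simp [en, EuclideanSpace.norm_sq_eq]

theorem en_eq_sqrt (x : ι → ℝ) : en x = √(∑ i, x i ^ 2) := by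
  rw [← en_sq, Real.sqrt_sq (en_nonneg x)]

theorem en_sq_eq_dotProduct (x : ι → ℝ) : en x ^ 2 = x ⬝ᵥ x := by
  rw [en_sq]
  simp [dotProduct, pow_two]

theorem en_le_of_sq_le {x : ι → ℝ} {C : ℝ} (hC : 0 ≤ C) (h : ∑ i, x i ^ 2 ≤ C ^ 2) : en x ≤ C := by
  rw [en_eq_sqrt]
  exact Real.sqrt_le_iff.2 ⟨hC, h⟩

@[simp] theorem en_zero : en (0 : ι → ℝ) = 0 := by simp [en]

theorem en_eq_zero {x : ι → ℝ} : en x = 0 ↔ x = 0 := by simp [en]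

theorem en_add_le (x y : ι → ℝ) : en (x + y) ≤ en x + en y := by
  simpa [en] using norm_add_le (WithLp.toLp 2 x) (WithLp.toLp 2 y)

theorem en_neg (x : ι → ℝ) : en (-x) = en x := by simp [en]

theorem en_sub_comm (x y : ι → ℝ) : en (x - y) = en (y - x) := by rw [← en_neg, neg_sub]

theorem en_smul (c : ℝ) (x : ι → ℝ) : en (c • x) = |c| * en x := by
  simp [en, norm_smul]

theorem en_le_en_add_sub (x y : ι → ℝ) : en x ≤ en y + en (x - y) := by
  simpa using en_add_le y (x - y)

theorem en_mono {x y : ι → ℝ} (h : ∀ i, |x i| ≤ y i) : en x ≤ en y := by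
  rw [en_eq_sqrt, en_eq_sqrt]
  exact Real.sqrt_le_sqrt (Finset.sum_le_sum fun i _ => sq_le_sq' (by linarith [neg_abs_le (x i), h i])
    ((le_abs_self _).trans (h i)))

theorem en_abs (x : ι → ℝ) : en (fun i => |x i|) = en x := by simp [en_eq_sqrt]

theorem sum_abs_mul_abs_le (x y : ι → ℝ) : ∑ i, |x i| * |y i| ≤ en x * en y := by
  have := Real.sum_mul_le_sqrt_mul_sqrt Finset.univ (fun i => |x i|) (fun i => |y i|)
  simpa [en_eq_sqrt] using this

theorem dotProduct_le_en_mul_en (x y : ι → ℝ) : x ⬝ᵥ y ≤ en x * en y := by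
  simpa [en_eq_sqrt, dotProduct] using Real.sum_mul_le_sqrt_mul_sqrt Finset.univ x y

end en

/-! ### Spectral norm and pseudo-inverse -/

section norms

variable {l m n : ℕ}

theorem specNorm_nonneg (M : Matrix (Fin m) (Fin n) ℝ) : 0 ≤ specNorm M := by
  open scoped Matrix.Norms.L2Operator in exact norm_nonneg M

theorem en_mulVec_le (M : Matrix (Fin m) (Fin n) ℝ) (x : Fin n → ℝ) :
    en (M *ᵥ x) ≤ specNorm M * en x :=
  M.l2_opNorm_mulVec (WithLp.toLp 2 x)

theorem specNorm_le {M : Matrix (Fin m) (Fin n) ℝ} {C : ℝ} (hC : 0 ≤ C)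
    (h : ∀ x, en (M *ᵥ x) ≤ C * en x) : specNorm M ≤ C := by
  unfold specNorm
  rw [Matrix.l2_opNorm_def]
  exact ContinuousLinearMap.opNorm_le_bound _ hC fun x => h x.ofLp

theorem specNorm_transpose (M : Matrix (Fin m) (Fin n) ℝ) : specNorm Mᵀ = specNorm M := by
  have := M.l2_opNorm_conjTranspose
  rwa [Matrix.conjTranspose_eq_transpose_of_trivial] at this

theorem specNorm_mul_le (M : Matrix (Fin l) (Fin m) ℝ) (N : Matrix (Fin m) (Fin n) ℝ) :
    specNorm (M * N) ≤ specNorm M * specNorm N :=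
  M.l2_opNorm_mul N

theorem specNorm_add_le (M N : Matrix (Fin m) (Fin n) ℝ) :
    specNorm (M + N) ≤ specNorm M + specNorm N := by
  open scoped Matrix.Norms.L2Operator in exact norm_add_le M N

theorem en_mulVec_of_transpose_mul_self {Q : Matrix (Fin m) (Fin n) ℝ} (h : Qᵀ * Q = 1)
    (x : Fin n → ℝ) : en (Q *ᵥ x) = en x := by
  have : en (Q *ᵥ x) ^ 2 = en x ^ 2 := by
    rw [en_sq_eq_dotProduct, en_sq_eq_dotProduct, Matrix.dotProduct_mulVec,
      Matrix.vecMul_mulVec, h, Matrix.vecMul_one]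
  exact (pow_left_inj₀ (en_nonneg _) (en_nonneg _) two_ne_zero).1 this

theorem pinv_mul_self {M : Matrix (Fin m) (Fin n) ℝ} (h : LinearIndependent ℝ M.col) :
    pinv M * M = 1 := by
  have hinj := Matrix.mulVec_injective_iff.2 h
  have hu : IsUnit (Mᵀ * M) := by
    rw [← Matrix.mulVec_injective_iff_isUnit]
    intro x y hxy
    apply hinj
    rw [← sub_eq_zero, ← Matrix.mulVec_sub] at hxy ⊢
    rw [← en_eq_zero, ← sq_eq_zero_iff, en_sq_eq_dotProduct, Matrix.dotProduct_mulVec,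
      Matrix.vecMul_mulVec, ← Matrix.mulVec_transpose, Matrix.transpose_mul,
      Matrix.transpose_transpose, hxy, zero_dotProduct]
  rw [pinv, Matrix.mul_assoc]
  exact Matrix.nonsing_inv_mul _ ((Matrix.isUnit_iff_isUnit_det _).1 hu)

theorem en_le_specNorm_pinv_mul {M : Matrix (Fin m) (Fin n) ℝ} (h : LinearIndependent ℝ M.col)
    (x : Fin n → ℝ) : en x ≤ specNorm (pinv M) * en (M *ᵥ x) := by
  have := en_mulVec_le (pinv M) (M *ᵥ x)
  rwa [Matrix.mulVec_mulVec, pinv_mul_self h, Matrix.one_mulVec] at this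

theorem linearIndependent_col_of_le_en {M : Matrix (Fin m) (Fin n) ℝ} {μ : ℝ} (hμ : 0 < μ)
    (h : ∀ x, μ * en x ≤ en (M *ᵥ x)) : LinearIndependent ℝ M.col := by
  rw [← Matrix.mulVec_injective_iff]
  intro x y hxy
  have := h (x - y)
  rw [Matrix.mulVec_sub, sub_eq_zero.2 hxy, en_zero] at this
  have h0 : en (x - y) = 0 := le_antisymm (by nlinarith [en_nonneg (x - y)]) (en_nonneg _)
  exact sub_eq_zero.1 (en_eq_zero.1 h0)

/-- `M M†` is an orthogonal projection: the normal equations give `‖M z‖² = ⟨M z, y⟩` for `z = M†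
y`, hence `μ ‖z‖ ≤ ‖M z‖ ≤ ‖y‖`. -/
theorem specNorm_pinv_le {M : Matrix (Fin m) (Fin n) ℝ} {μ : ℝ} (hμ : 0 < μ)
    (h : ∀ x, μ * en x ≤ en (M *ᵥ x)) : specNorm (pinv M) ≤ 1 / μ := by
  have hM := pinv_mul_self (linearIndependent_col_of_le_en hμ h)
  refine specNorm_le (by positivity) fun y => ?_
  set z := pinv M *ᵥ y with hz
  have hproj : Mᵀ *ᵥ (M *ᵥ z) = Mᵀ *ᵥ y := by
    have hdet : IsUnit (Mᵀ * M).det := by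
      have h1 : (Mᵀ * M)⁻¹ * (Mᵀ * M) = 1 := by rw [← Matrix.mul_assoc]; exact hM
      exact Matrix.isUnit_det_of_left_inverse h1
    rw [hz, pinv, Matrix.mulVec_mulVec, Matrix.mulVec_mulVec, ← Matrix.mul_assoc,
      Matrix.mul_nonsing_inv _ hdet, Matrix.one_mul]
  have hsq : en (M *ᵥ z) ^ 2 ≤ en (M *ᵥ z) * en y := by
    have h2 : en (M *ᵥ z) ^ 2 = (M *ᵥ z) ⬝ᵥ y := by
      rw [en_sq_eq_dotProduct, dotProduct_comm _ y, Matrix.dotProduct_mulVec (M *ᵥ z),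
        Matrix.dotProduct_mulVec y, ← Matrix.mulVec_transpose, ← Matrix.mulVec_transpose, hproj]
    rw [h2]
    exact dotProduct_le_en_mul_en _ _
  have hle : en (M *ᵥ z) ≤ en y := by
    by_contra hlt
    push Not at hlt
    nlinarith [en_nonneg y]
  rw [one_div, ← div_eq_inv_mul, le_div_iff₀ hμ, mul_comm]
  exact (h z).trans hle

theorem one_le_cond2 {M : Matrix (Fin m) (Fin n) ℝ} (hn : 0 < n)
    (h : LinearIndependent ℝ M.col) : 1 ≤ cond2 M := by
  set x : Fin n → ℝ := Pi.single ⟨0, hn⟩ 1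
  have hx : 0 < en x := by
    refine (en_nonneg x).lt_of_ne' fun h0 => ?_
    have := congrFun (en_eq_zero.1 h0) ⟨0, hn⟩
    simp [x] at this
  have h1 := en_le_specNorm_pinv_mul h x
  have h2 := mul_le_mul_of_nonneg_left (en_mulVec_le M x) (specNorm_nonneg (pinv M))
  unfold cond2
  nlinarith

/-! ### Frobenius norm -/

/-- The Frobenius norm of a matrix. -/
noncomputable def fro (M : Matrix (Fin m) (Fin n) ℝ) : ℝ :=
  en fun p : Fin m × Fin n => M p.1 p.2

theorem fro_nonneg (M : Matrix (Fin m) (Fin n) ℝ) : 0 ≤ fro M := en_nonneg _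

theorem fro_sq_eq_row (M : Matrix (Fin m) (Fin n) ℝ) : fro M ^ 2 = ∑ i, en (M i) ^ 2 := by
  simp [fro, en_sq, Fintype.sum_prod_type]

theorem fro_sq_eq_col (M : Matrix (Fin m) (Fin n) ℝ) : fro M ^ 2 = ∑ j, en (M.col j) ^ 2 := by
  simp [fro, en_sq, Fintype.sum_prod_type_right]

theorem fro_transpose (M : Matrix (Fin m) (Fin n) ℝ) : fro Mᵀ = fro M := by
  have : fro Mᵀ ^ 2 = fro M ^ 2 := by rw [fro_sq_eq_row, fro_sq_eq_col]; rfl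
  exact (pow_left_inj₀ (fro_nonneg _) (fro_nonneg _) two_ne_zero).1 this

theorem specNorm_le_fro (M : Matrix (Fin m) (Fin n) ℝ) : specNorm M ≤ fro M := by
  refine specNorm_le (fro_nonneg _) fun x => ?_
  refine en_le_of_sq_le (mul_nonneg (fro_nonneg _) (en_nonneg _)) ?_
  rw [mul_pow, fro_sq_eq_row, Finset.sum_mul]
  refine Finset.sum_le_sum fun i _ => ?_
  rw [← mul_pow, ← sq_abs]
  refine pow_le_pow_left₀ (abs_nonneg _) ?_ 2
  rw [Matrix.mulVec, dotProduct]
  refine ((Finset.abs_sum_le_sum_abs _ _).trans_eq ?_).trans (sum_abs_mul_abs_le (M i) x)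
  simp [abs_mul]

theorem fro_le_sqrt_mul_specNorm (M : Matrix (Fin m) (Fin n) ℝ) :
    fro M ≤ √(n : ℝ) * specNorm M := by
  refine en_le_of_sq_le (mul_nonneg (Real.sqrt_nonneg _) (specNorm_nonneg _)) ?_
  have h := fro_sq_eq_col M
  rw [fro, en_sq] at h
  rw [h, mul_pow, Real.sq_sqrt (Nat.cast_nonneg n)]
  have : ∀ j ∈ (Finset.univ : Finset (Fin n)), en (M.col j) ^ 2 ≤ specNorm M ^ 2 := fun j _ => by
    refine pow_le_pow_left₀ (en_nonneg _) ?_ 2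
    have h1 : en (Pi.single j 1 : Fin n → ℝ) = 1 := by simp [en]
    have := en_mulVec_le M (Pi.single j 1)
    rwa [Matrix.mulVec_single_one, h1, mul_one] at this
  simpa using Finset.sum_le_sum this

theorem fro_le_sqrt_mul_specNorm_of_rows (M : Matrix (Fin m) (Fin n) ℝ) :
    fro M ≤ √(m : ℝ) * specNorm M := by
  rw [← fro_transpose, ← specNorm_transpose]
  exact fro_le_sqrt_mul_specNorm _

theorem fro_le_of_entry_le_abs_mul {E : Matrix (Fin l) (Fin n) ℝ} {M : Matrix (Fin l) (Fin m) ℝ}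
    {N : Matrix (Fin m) (Fin n) ℝ} {g : ℝ} (hg : 0 ≤ g)
    (h : ∀ i j, |E i j| ≤ g * ∑ k, |M i k| * |N k j|) : fro E ≤ g * (fro M * fro N) := by
  refine en_le_of_sq_le (mul_nonneg hg (mul_nonneg (fro_nonneg _) (fro_nonneg _))) ?_
  rw [mul_pow, mul_pow, fro_sq_eq_row M, fro_sq_eq_col N, Finset.sum_mul_sum, Finset.mul_sum,
    Fintype.sum_prod_type]
  refine Finset.sum_le_sum fun i _ => ?_
  rw [Finset.mul_sum]
  refine Finset.sum_le_sum fun j _ => ?_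
  rw [← mul_pow, ← mul_pow, ← sq_abs]
  exact pow_le_pow_left₀ (abs_nonneg _)
    ((h i j).trans (mul_le_mul_of_nonneg_left (sum_abs_mul_abs_le (M i) (N.col j)) hg)) 2

theorem fro_le_of_col_le {E M : Matrix (Fin m) (Fin n) ℝ} {g : ℝ} (hg : 0 ≤ g)
    (h : ∀ j, en (E.col j) ≤ g * en (M.col j)) : fro E ≤ g * fro M := by
  refine (pow_le_pow_iff_left₀ (fro_nonneg _) (mul_nonneg hg (fro_nonneg _)) two_ne_zero).1 ?_
  rw [mul_pow, fro_sq_eq_col, fro_sq_eq_col, Finset.mul_sum]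
  refine Finset.sum_le_sum fun j _ => ?_
  rw [← mul_pow]
  exact pow_le_pow_left₀ (en_nonneg _) (h j) 2

end norms

/-! ### Matrix product -/

theorem FlMul.specNorm_sub_le {s m n : ℕ} {u : ℝ} (hu0 : 0 ≤ u) (hu : u < 1) (hm : m * u < 1)
    {M : Matrix (Fin s) (Fin m) ℝ} {N : Matrix (Fin m) (Fin n) ℝ} {P : Matrix (Fin s) (Fin n) ℝ}
    (h : FlMul u M N P) :
    specNorm (P - M * N) ≤ √((s : ℝ) * n) * gam u m * (specNorm M * specNorm N) := by
  have hg := gam_nonneg hu0 hm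
  have hE : ∀ i j, |(P - M * N) i j| ≤ gam u m * ∑ k, |M i k| * |N k j| := fun i j => by
    obtain ⟨ρ, hρ, hP⟩ := (h i j).exists_relErr hu0 hu
    simp only [Finset.card_univ, Fintype.card_fin] at hρ
    rw [Matrix.sub_apply, hP, Matrix.mul_apply]
    simpa only [abs_mul] using abs_sum_mul_relErr_sub_le hu hm Finset.univ
      (a := fun k => M i k * N k j) hρ
  refine (specNorm_le_fro _).trans ((fro_le_of_entry_le_abs_mul hg hE).trans ?_)
  have := mul_le_mul (fro_le_sqrt_mul_specNorm_of_rows M) (fro_le_sqrt_mul_specNorm N)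
    (fro_nonneg _) (mul_nonneg (Real.sqrt_nonneg _) (specNorm_nonneg _))
  refine (mul_le_mul_of_nonneg_left this hg).trans_eq ?_
  rw [Real.sqrt_mul (Nat.cast_nonneg s)]
  ring

/-! ### Householder QR -/

section reflector

variable {s : ℕ}

/-- The reflector `I - β v vᵀ`. -/
def reflector (β : ℝ) (v : Fin s → ℝ) : Matrix (Fin s) (Fin s) ℝ := 1 - β • vecMulVec v v

theorem reflector_mulVec (β : ℝ) (v b : Fin s → ℝ) :
    reflector β v *ᵥ b = b - (β * (v ⬝ᵥ b)) • v := by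
  ext i
  simp [reflector, Matrix.sub_mulVec, Matrix.smul_mulVec, Matrix.vecMulVec_mulVec]
  ring

theorem en_reflector_mulVec {β : ℝ} {v : Fin s → ℝ} (h : β * (v ⬝ᵥ v) = 2) (b : Fin s → ℝ) :
    en (reflector β v *ᵥ b) = en b := by
  refine (pow_left_inj₀ (en_nonneg _) (en_nonneg _) two_ne_zero).1 ?_
  rw [reflector_mulVec, en_sq_eq_dotProduct, en_sq_eq_dotProduct]
  simp only [sub_dotProduct, dotProduct_sub, smul_dotProduct, dotProduct_smul, smul_eq_mul,
    dotProduct_comm b v]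
  linear_combination β * (v ⬝ᵥ b) ^ 2 * h

end reflector

/-! ### A single computed Householder step. -/

section step

variable {s n : ℕ} {u : ℝ} {p : Fin s} {k : Fin n} {W W' : Matrix (Fin s) (Fin n) ℝ}

theorem HouseholderStep.col_eq (h : HouseholderStep u p k W W') (i : Fin s) {j : Fin n}
    (hj : j < k) : W' i j = W i j := by
  obtain ⟨σ, -, ⟨-, rfl⟩ | ⟨-, τ, d, β, v, -, -, -, -, -, h, -⟩⟩ := h
  · rfl
  · exact h i j (.inr hj)

theorem HouseholderStep.eliminated (hu0 : 0 ≤ u) (hu : u < 1) (h : HouseholderStep u p k W W')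
    {i : Fin s} (hi : p < i) : W' i k = 0 := by
  obtain ⟨σ, hσ, ⟨h0, rfl⟩ | ⟨-, τ, d, β, v, -, -, -, -, -, -, -, h, -⟩⟩ := h
  -- The rounding factor is positive, so a computed norm `0` means that the column part is exactly
  -- zero.
  · obtain ⟨ρ, hρ, rfl⟩ := hσ.exists_relErr hu0 hu
    have h1 := (mul_eq_zero.1 h0).resolve_right (hρ.pos hu).ne'
    rw [Real.sqrt_eq_zero (Finset.sum_nonneg fun i _ => sq_nonneg _)] at h1
    exact pow_eq_zero_iff two_ne_zero |>.1 <|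
      (Finset.sum_eq_zero_iff_of_nonneg fun i _ => sq_nonneg _).1 h1 i (Finset.mem_Ici.2 hi.le)
  · exact h i hi

/-- The rounding errors of a computed reflector application, in norm. -/
theorem en_le_of_reflector_error {β g : ℝ} {v b e : Fin s → ℝ} (h : |β| * en v ^ 2 = 2)
    (hg : 0 ≤ g) (he : ∀ i, |e i| ≤ g * (|b i| + |β| * |v i| * ∑ l, |v l| * |b l|)) :
    en e ≤ 3 * g * en b := by
  set T := ∑ l, |v l| * |b l| with hT
  have hT0 : 0 ≤ T := Finset.sum_nonneg fun l _ => by positivity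
  have h1 : en e ≤ en (g • ((fun i => |b i|) + (|β| * T) • fun i => |v i|)) :=
    en_mono fun i => (he i).trans_eq (by
      simp only [Pi.smul_apply, Pi.add_apply, smul_eq_mul]; ring)
  have h2 := en_add_le (fun i => |b i|) ((|β| * T) • fun i => |v i|)
  rw [en_smul, abs_of_nonneg hg] at h1
  rw [en_smul, en_abs, en_abs, abs_of_nonneg (mul_nonneg (abs_nonneg β) hT0)] at h2
  have h3 : |β| * T * en v ≤ 2 * en b := by
    calc |β| * T * en v ≤ |β| * (en v * en b) * en v := by
          have := sum_abs_mul_abs_le v b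
          have := en_nonneg v
          gcongr
      _ = |β| * en v ^ 2 * en b := by ring
      _ = 2 * en b := by rw [h]
  calc en e ≤ g * (en b + 2 * en b) := h1.trans (mul_le_mul_of_nonneg_left (by linarith) hg)
    _ = 3 * g * en b := by ring

/-- `P` is the exact reflector of the given `W`. The computed `v` and `β` differ from its data only
by relative factors. -/
theorem HouseholderStep.exists_isometry (hs : 2 ≤ s) (hu0 : 0 ≤ u) (hu : u < 1)
    (hk : ((11 * s : ℕ) : ℝ) * u < 1) (h : HouseholderStep u p k W W')
    (hW : ∀ i j, p ≤ i → j < k → W i j = 0) :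
    ∃ P : Matrix (Fin s) (Fin s) ℝ, (∀ x, en (P *ᵥ x) = en x) ∧
      ∀ j, en (W'.col j - P *ᵥ W.col j) ≤ 3 * gam u (11 * s) * en (W.col j) := by
  have hg := gam_nonneg hu0 hk
  have hcol := fun i j => h.col_eq i (j := j)
  obtain ⟨σ, hσ, ⟨-, rfl⟩ | ⟨hσ0, τ, d, β, v, hτ, hvp, hvi, hd, hβ, hsame, hpk, hik, hupd⟩⟩ := h
  · refine ⟨1, fun x => by rw [Matrix.one_mulVec], fun j => ?_⟩
    rw [Matrix.one_mulVec, sub_self, en_zero]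
    have := en_nonneg (W'.col j)
    positivity
  have hcard : (Finset.Ici p).card ≤ s := by
    simp
  obtain ⟨ρ, hρ, hσeq⟩ := hσ.exists_relErr hu0 hu
  replace hρ := hρ.mono hu0 hu (Nat.succ_le_succ hcard)
  -- the exact quantities
  set σ' := √(∑ i ∈ Finset.Ici p, W i k ^ 2) with hσ'
  set τ' := if W p k < 0 then -σ' else σ' with hτ'
  set x : Fin s → ℝ := fun i => if p ≤ i then W i k else 0 with hx
  set v' : Fin s → ℝ := x + Pi.single p τ' with hv'
  have hσ'pos : 0 < σ' := by
    refine (Real.sqrt_nonneg _).lt_of_ne' fun h0 => hσ0 ?_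
    have h0' : σ' = 0 := h0
    rw [hσeq, h0', zero_mul]
  have hττ : τ = τ' * ρ := by
    rw [hτ, hσeq, hτ']; split_ifs <;> ring
  have hτsq : τ' ^ 2 = σ' ^ 2 := by rw [hτ']; split_ifs <;> ring
  have habs : |τ'| = σ' := by
    rw [hτ']; split_ifs <;> simp [abs_of_pos hσ'pos]
  -- The sign choice prevents cancellation in `v_p`, which therefore has a small relative error.
  have hsign : (0 ≤ W p k ∧ 0 ≤ τ') ∨ (W p k ≤ 0 ∧ τ' ≤ 0) := by
    rw [hτ']
    split_ifs with hneg
    · exact .inr ⟨hneg.le, by linarith⟩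
    · exact .inl ⟨not_lt.1 hneg, hσ'pos.le⟩
  have hτ0 : τ' ≠ 0 := fun h0 => by rw [h0, abs_zero] at habs; exact hσ'pos.ne habs
  have hv'p : v' p = W p k + τ' := by simp [hv', hx]
  have hv'gt : ∀ i, p < i → v' i = W i k := fun i hi => by simp [hv', hx, hi.le, hi.ne']
  have hv'lt : ∀ i, i < p → v' i = 0 := fun i hi => by simp [hv', hx, hi.not_ge, hi.ne]
  have hv'p0 : v' p ≠ 0 := by
    rw [hv'p]
    rcases hsign with ⟨h1, h2⟩ | ⟨h1, h2⟩
    · have := lt_of_le_of_ne h2 hτ0.symm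
      linarith
    · have := lt_of_le_of_ne h2 hτ0
      linarith
  have hdot : ∀ b : Fin s → ℝ, v' ⬝ᵥ b = ∑ l ∈ Finset.Ici p, v' l * b l := fun b =>
    (Finset.sum_subset (Finset.subset_univ _) fun l _ hl => by
      rw [hv'lt l (not_le.1 fun h => hl (Finset.mem_Ici.2 h)), zero_mul]).symm
  have hxx : x ⬝ᵥ x = σ' ^ 2 := by
    rw [hσ', Real.sq_sqrt (Finset.sum_nonneg fun i _ => sq_nonneg _), dotProduct]
    rw [← Finset.sum_subset (Finset.subset_univ (Finset.Ici p))]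
    · exact Finset.sum_congr rfl fun i hi => by simp [hx, Finset.mem_Ici.1 hi, pow_two]
    · intro i _ hi
      have : ¬ p ≤ i := fun h => hi (Finset.mem_Ici.2 h)
      simp [hx, this]
  have hxp : x p = W p k := by simp [hx]
  have hvv : v' ⬝ᵥ v' = 2 * (τ' * v' p) := by
    rw [hv'p, hv']
    simp only [add_dotProduct, dotProduct_add, hxx, single_dotProduct, dotProduct_single,
      Pi.add_apply, Pi.single_eq_same, hxp]
    linear_combination -hτsq
  have hvx : v' ⬝ᵥ W.col k = τ' * v' p := by
    have h1 : v' ⬝ᵥ W.col k = v' ⬝ᵥ x := by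
      rw [hdot, hdot]
      exact Finset.sum_congr rfl fun i hi => by simp [hx, Finset.mem_Ici.1 hi]
    rw [h1, hv'p, hv']
    simp only [add_dotProduct, hxx, single_dotProduct, hxp]
    linear_combination -hτsq
  set β' := 1 / (τ' * v' p) with hβ'
  have hτv0 : τ' * v' p ≠ 0 := mul_ne_zero hτ0 hv'p0
  have hβvv : β' * (v' ⬝ᵥ v') = 2 := by rw [hvv, hβ']; field_simp
  have hβen : |β'| * en v' ^ 2 = 2 := by
    rw [← abs_of_nonneg (sq_nonneg (en v')), ← abs_mul, en_sq_eq_dotProduct, hβvv]; norm_num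
  -- relative errors of the computed reflector
  obtain ⟨ρv, hρv, hvp'⟩ : ∃ r, RelErr u (s + 2) r ∧ v p = v' p * r := by
    obtain ⟨μ, hμ, h1⟩ := RelErr.exists_of_isFl hu hvp
    obtain ⟨r, hr, h2⟩ := RelErr.add_same_sign hu0 hu hsign (RelErr.one hu0 hu (s + 1)) hρ
    refine ⟨r * μ, hr.mul hu hμ, ?_⟩
    rw [h1, hv'p, hττ, ← mul_assoc, ← h2, mul_one]
  obtain ⟨r, hr, hvr⟩ : ∃ r : Fin s → ℝ, (∀ i, RelErr u (s + 2) (r i)) ∧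
      ∀ i, p ≤ i → v i = v' i * r i := by
    refine ⟨fun i => if i = p then ρv else 1, fun i => ?_, fun i hi => ?_⟩
    · dsimp only
      split_ifs
      · exact hρv
      · exact .one hu0 hu _
    · rcases hi.eq_or_lt with rfl | hlt
      · simpa using hvp'
      · simp [hlt.ne', hvi i hlt, hv'gt i hlt]
  obtain ⟨ρβ, hρβ, hββ⟩ : ∃ r, RelErr u (2 * s + 5) r ∧ β = β' * r := by
    obtain ⟨μ, hμ, rfl⟩ := RelErr.exists_of_isFl hu hd
    obtain ⟨ν, hν, rfl⟩ := RelErr.exists_of_isFl hu hβ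
    refine ⟨(ρ * ρv * μ)⁻¹ * ν,
      ((((hρ.mul hu hρv).mul hu hμ).inv hu).mul hu hν).mono hu0 hu (by omega), ?_⟩
    have := (hρ.pos hu).ne'
    have := (hρv.pos hu).ne'
    have := (hμ.pos hu).ne'
    rw [hττ, hvp', hβ']
    field_simp
  refine ⟨reflector β' v', en_reflector_mulVec hβvv, fun j => ?_⟩
  rw [reflector_mulVec]
  rcases lt_trichotomy j k with hjk | rfl | hjk
  -- Earlier columns vanish on the rows where `v'` lives, so the reflector fixes them.
  · have h0 : v' ⬝ᵥ W.col j = 0 := by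
      rw [hdot]
      exact Finset.sum_eq_zero fun i hi => by
        rw [Matrix.col_apply, hW i j (Finset.mem_Ici.1 hi) hjk, mul_zero]
    have h1 : W'.col j = W.col j := funext fun i => hcol i j hjk
    rw [h0, h1, mul_zero, zero_smul, sub_zero, sub_self, en_zero]
    have := en_nonneg (W.col j)
    positivity
  -- The exact reflector takes the pivot column's tail to `-τ' e_p`; only the error of `τ` remains.
  · have h1 : W'.col j - (W.col j - (β' * (v' ⬝ᵥ W.col j)) • v') =
        Pi.single p (τ' - τ) := by
      have h2 : β' * (v' ⬝ᵥ W.col j) = 1 := by rw [hvx, hβ']; field_simp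
      rw [h2, one_smul]
      ext i
      rcases lt_trichotomy i p with hi | rfl | hi
      · simp [hsame i j (.inl hi), hv'lt i hi, hi.ne]
      · simp [hpk, hv'p]; ring
      · simp [hik i hi, hv'gt i hi, hi.ne']
    have h3 : en (Pi.single p (τ' - τ) : Fin s → ℝ) = |τ' - τ| := by simp [en]
    have h4 : |τ' - τ| ≤ gam u (11 * s) * σ' := by
      have := (hρ.mono hu0 hu (show s + 1 ≤ 11 * s by omega)).abs_sub_one_le hu hk
      rw [hττ, abs_sub_comm, show τ' * ρ - τ' = (ρ - 1) * τ' by ring, abs_mul, habs]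
      exact mul_le_mul_of_nonneg_right this hσ'pos.le
    have h5 : σ' ≤ en (W.col j) := by
      rw [en_eq_sqrt]
      exact Real.sqrt_le_sqrt (Finset.sum_le_sum_of_subset_of_nonneg (Finset.subset_univ _)
        fun i _ _ => sq_nonneg _)
    rw [h1, h3]
    have := mul_le_mul_of_nonneg_left h5 hg
    have := mul_nonneg hg (en_nonneg (W.col j))
    linarith
  · obtain ⟨w, t, hw, ht, hq⟩ := hupd j hjk
    refine en_le_of_reflector_error hβen hg fun i => ?_
    rcases lt_or_ge i p with hi | hi
    · have : (W'.col j - (W.col j - (β' * (v' ⬝ᵥ W.col j)) • v')) i = 0 := by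
        simp [hsame i j (.inl hi), hv'lt i hi]
      rw [this, abs_zero]
      have : 0 ≤ ∑ l, |v' l| * |W.col j l| := Finset.sum_nonneg fun l _ => by positivity
      positivity
    obtain ⟨ρw, hρw, hw⟩ := hw.exists_relErr hu0 hu
    obtain ⟨μt, hμt, ht⟩ := RelErr.exists_of_isFl hu ht
    obtain ⟨q, hq, hW'⟩ := hq i hi
    obtain ⟨μq, hμq, hq⟩ := RelErr.exists_of_isFl hu hq
    obtain ⟨ν, hν, hW'⟩ := RelErr.exists_of_isFl hu hW'
    set a : Fin s → ℝ := fun l => β' * v' i * (v' l * W l j) with ha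
    set R : Fin s → ℝ := fun l => ρβ * (r l * ρw l) * μt * r i * μq * ν with hR
    -- At most `(2s+5) + (s+2) + s + 1 + (s+2) + 1 + 1 = 5s + 12` factors, and `5s + 12 ≤ 11s`
    -- because `s ≥ 2`.
    have hRerr : ∀ l ∈ Finset.Ici p, RelErr u (11 * s) (R l) := fun l hl =>
      ((((((hρβ.mul hu ((hr l).mul hu (hρw l hl))).mul hu hμt).mul hu (hr i)).mul hu hμq).mul hu
        hν).mono hu0 hu (by omega))
    have hsum : W' i j = W i j * ν - ∑ l ∈ Finset.Ici p, a l * R l := by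
      rw [hW', hq, ht, hw, hββ, hvr i hi, sub_mul, Finset.mul_sum, Finset.sum_mul, Finset.sum_mul,
        Finset.sum_mul, Finset.sum_mul]
      congr 1
      refine Finset.sum_congr rfl fun l hl => ?_
      rw [hvr l (Finset.mem_Ici.1 hl), ha, hR]
      ring
    have hdiff : (W'.col j - (W.col j - (β' * (v' ⬝ᵥ W.col j)) • v')) i =
        (ν - 1) * W i j - (∑ l ∈ Finset.Ici p, a l * R l - ∑ l ∈ Finset.Ici p, a l) := by
      simp only [Pi.sub_apply, Pi.smul_apply, smul_eq_mul, Matrix.col_apply, hdot, hsum, ha,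
        ← Finset.mul_sum]
      ring
    have h1 := abs_sum_mul_relErr_sub_le hu hk (Finset.Ici p) (a := a) hRerr
    have h2 := (hν.mono hu0 hu (show 1 ≤ 11 * s by omega)).abs_sub_one_le hu hk
    have h3 : ∑ l ∈ Finset.Ici p, |a l| ≤ |β'| * |v' i| * ∑ l, |v' l| * |W.col j l| := by
      rw [Finset.mul_sum]
      refine (Finset.sum_le_sum_of_subset_of_nonneg (Finset.subset_univ _)
        fun i _ _ => abs_nonneg _).trans_eq (Finset.sum_congr rfl fun l _ => ?_)
      simp [ha, abs_mul]
    rw [hdiff]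
    calc _ ≤ |(ν - 1) * W i j| + |∑ l ∈ Finset.Ici p, a l * R l - ∑ l ∈ Finset.Ici p, a l| :=
          abs_sub _ _
      _ ≤ gam u (11 * s) * |W i j| + gam u (11 * s) *
          (|β'| * |v' i| * ∑ l, |v' l| * |W.col j l|) := by
        rw [abs_mul]
        exact add_le_add (mul_le_mul_of_nonneg_right h2 (abs_nonneg _))
          (h1.trans (mul_le_mul_of_nonneg_left h3 hg))
      _ = _ := by rw [Matrix.col_apply]; ring

end step

/-- `Q` is the product of the exact steps. Each step multiplies the bound on a column's norm by at
most `1 + ε`, whence the geometric growth of the error. -/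
theorem FlHouseholderR.exists_isometry {s n : ℕ} {u : ℝ} (hs : 2 ≤ s) (hu0 : 0 ≤ u) (hu : u < 1)
    (hk : ((11 * s : ℕ) : ℝ) * u < 1) {hns : n ≤ s} {B : Matrix (Fin s) (Fin n) ℝ}
    {R : Matrix (Fin n) (Fin n) ℝ} (h : FlHouseholderR u hns B R) :
    (∀ i j, j < i → R i j = 0) ∧
    ∃ (V : Matrix (Fin s) (Fin n) ℝ) (Q : Matrix (Fin s) (Fin s) ℝ),
      (∀ x, en (R *ᵥ x) = en (V *ᵥ x)) ∧ (∀ x, en (Q *ᵥ x) = en x) ∧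
      ∀ j, en (V.col j - Q *ᵥ B.col j) ≤
        ((1 + 3 * gam u (11 * s)) ^ n - 1) * en (B.col j) := by
  obtain ⟨W, rfl, hstep, hR⟩ := h
  have hg := gam_nonneg hu0 hk
  set ε := 3 * gam u (11 * s) with hε
  have hε0 : 0 ≤ ε := by positivity
  have hW : ∀ k ≤ n, (∀ (i : Fin s) (j : Fin n), j.1 < k → j.1 < i.1 → W k i j = 0) ∧
      ∃ Q : Matrix (Fin s) (Fin s) ℝ, (∀ x, en (Q *ᵥ x) = en x) ∧
        ∀ j, en ((W k).col j - Q *ᵥ (W 0).col j) ≤ ((1 + ε) ^ k - 1) * en ((W 0).col j) := by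
    intro k
    induction k with
    | zero => exact fun _ => ⟨by simp, 1, by simp, by simp⟩
    | succ k ih =>
      intro hkn
      obtain ⟨hz, Q, hQ, hE⟩ := ih (by omega)
      have hst := hstep ⟨k, hkn⟩
      simp only at hst
      constructor
      · intro i j hj hij
        rcases Nat.lt_succ_iff_lt_or_eq.1 hj with hlt | heq
        · rw [hst.col_eq i (Fin.lt_def.2 hlt)]
          exact hz i j hlt hij
        · have : j = ⟨k, hkn⟩ := Fin.ext heq
          subst this
          exact hst.eliminated hu0 hu (Fin.lt_def.2 hij)
      · obtain ⟨P, hP, hPE⟩ := hst.exists_isometry hs hu0 hu hk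
          fun i j hi hj => hz i j hj (lt_of_lt_of_le hj hi)
        refine ⟨P * Q, fun x => by rw [← Matrix.mulVec_mulVec, hP, hQ], fun j => ?_⟩
        set b := (W 0).col j
        have h1 : (W (k + 1)).col j - (P * Q) *ᵥ b =
            ((W (k + 1)).col j - P *ᵥ (W k).col j) + P *ᵥ ((W k).col j - Q *ᵥ b) := by
          rw [Matrix.mulVec_sub, Matrix.mulVec_mulVec]; abel
        have h2 := hE j
        have h3 := hPE j
        have h4 : en ((W k).col j) ≤ en b + en ((W k).col j - Q *ᵥ b) := by
          have := en_le_en_add_sub ((W k).col j) (Q *ᵥ b)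
          rwa [hQ] at this
        rw [h1]
        refine (en_add_le _ _).trans ?_
        rw [hP, pow_succ]
        nlinarith [en_nonneg b]
  obtain ⟨hz, Q, hQ, hE⟩ := hW n le_rfl
  refine ⟨fun i j hij => by rw [hR]; exact hz _ j j.2 hij, W n, Q, fun x => ?_, hQ, hE⟩
  refine (pow_left_inj₀ (en_nonneg _) (en_nonneg _) two_ne_zero).1 ?_
  -- The rows of `W n` from index `n` on are zero, so truncation to `R` keeps norms.
  rw [en_sq, en_sq, ← Finset.sum_subset (Finset.subset_univ
    (Finset.univ.map (Fin.castLEEmb hns))), Finset.sum_map]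
  · refine Finset.sum_congr rfl fun i _ => ?_
    simp [Matrix.mulVec, dotProduct, hR]
  · intro i _ hi
    have hni : n ≤ i.1 := by
      by_contra hlt
      exact hi (Finset.mem_map.2 ⟨⟨i, not_le.1 hlt⟩, Finset.mem_univ _, rfl⟩)
    have : (W n *ᵥ x) i = 0 := by
      rw [Matrix.mulVec, dotProduct]
      exact Finset.sum_eq_zero fun j _ => by rw [hz i j j.2 (by omega), zero_mul]
    rw [this]; ring

/-- Accumulation of `n` relative perturbations of size `ε`. -/
theorem one_add_pow_sub_one_le {ε y : ℝ} {n : ℕ} (hε : 0 ≤ ε) (hy : n * ε ≤ y) (hy1 : y < 1) :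
    (1 + ε) ^ n - 1 ≤ y / (1 - y) := by
  rcases n.eq_zero_or_pos with rfl | hn
  · simp at hy ⊢
    exact div_nonneg hy (by linarith)
  have hn1 : (1 : ℝ) ≤ n := by exact_mod_cast hn
  have hε1 : ε < 1 := by nlinarith
  have hb : 1 - n * ε ≤ (1 - ε) ^ n := by
    have := one_add_mul_le_pow (a := -ε) (by linarith) n
    simpa [sub_eq_add_neg] using this
  -- Thus `(1 + ε)^n ≤ 1 / (1 - ε)^n ≤ 1 / (1 - y)`.
  have hm : (1 + ε) ^ n * (1 - ε) ^ n ≤ 1 := by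
    rw [← mul_pow]
    exact pow_le_one₀ (by nlinarith) (by nlinarith)
  have hp : 0 < (1 + ε) ^ n := by positivity
  rw [le_div_iff₀ (by linarith)]
  nlinarith [mul_le_mul_of_nonneg_left (show 1 - y ≤ (1 - ε) ^ n by linarith) hp.le]

theorem FlHouseholderR.exists_perturbation {s n : ℕ} {u : ℝ} {c : ℕ} (hc : 34 ≤ c)
    (hs : 2 ≤ s) (hu0 : 0 ≤ u) (hu : u < 1)
    (hsu : 500 * s * u ≤ 1) (hk : ((c * s * n : ℕ) : ℝ) * u < 1)
    {hns : n ≤ s} {B : Matrix (Fin s) (Fin n) ℝ}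
    {R : Matrix (Fin n) (Fin n) ℝ} (h : FlHouseholderR u hns B R) :
    (∀ i j, j < i → R i j = 0) ∧
    ∃ (V : Matrix (Fin s) (Fin n) ℝ) (Q : Matrix (Fin s) (Fin s) ℝ),
      (∀ x, en (R *ᵥ x) = en (V *ᵥ x)) ∧ (∀ x, en (Q *ᵥ x) = en x) ∧
      specNorm (V - Q * B) ≤ √(n : ℝ) * gam u (c * s * n) * specNorm B := by
  have hsu' : ((11 * s : ℕ) : ℝ) * u < 1 := by push_cast; nlinarith
  obtain ⟨htri, V, Q, hV, hQ, hE⟩ := h.exists_isometry hs hu0 hu hsu'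
  refine ⟨htri, V, Q, hV, hQ, ?_⟩
  have hg := gam_nonneg hu0 hk
  have hsu0 : 0 ≤ (s : ℝ) * u := by positivity
  -- `33 / (1 - 11 s u) ≤ 34` as soon as `s u ≤ 1/374`; this fixes the lower bound on `c`.
  have hε : 3 * gam u (11 * s) ≤ 34 * (s * u) := by
    unfold gam
    push_cast at hsu' ⊢
    rw [← mul_div_assoc, div_le_iff₀ (by linarith)]
    nlinarith
  have hpow : (1 + 3 * gam u (11 * s)) ^ n - 1 ≤ gam u (c * s * n) := by
    refine one_add_pow_sub_one_le (mul_nonneg (by norm_num) (gam_nonneg hu0 hsu')) ?_ hk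
    have hc' : (34 : ℝ) ≤ c := by exact_mod_cast hc
    calc (n : ℝ) * (3 * gam u (11 * s)) ≤ n * (34 * (s * u)) := by gcongr
      _ ≤ n * (c * (s * u)) := by gcongr
      _ = _ := by push_cast; ring
  have hcol : ∀ j, en ((V - Q * B).col j) ≤ gam u (c * s * n) * en (B.col j) := fun j =>
    (hE j).trans (mul_le_mul_of_nonneg_right hpow (en_nonneg _))
  refine (specNorm_le_fro _).trans ((fro_le_of_col_le hg hcol).trans ?_)
  have := mul_le_mul_of_nonneg_left (fro_le_sqrt_mul_specNorm B) hg
  linarith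

/-! ### Forward substitution -/

theorem FlForwardSubst.abs_residual_le {n : ℕ} {u : ℝ} (hu0 : 0 ≤ u) (hu : u < 1)
    (hk : ((2 * n : ℕ) : ℝ) * u < 1) {R : Matrix (Fin n) (Fin n) ℝ} (hR : ∀ i j, j < i → R i j = 0)
    (hd : ∀ i, R i i ≠ 0) {a y : Fin n → ℝ} (h : FlForwardSubst u R a y) (i : Fin n) :
    |a i - ∑ j, y j * R j i| ≤ gam u (2 * n) * ∑ j, |y j| * |R j i| := by
  obtain ⟨p, t, hp, ht, hy⟩ := h i
  obtain ⟨ρ, hρ, ht⟩ := ht.exists_relErr hu0 hu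
  obtain ⟨ν, hν, hy⟩ := RelErr.exists_of_isFl hu hy
  have hp' : ∀ j, ∃ μ, RelErr u 1 μ ∧ (j < i → p j = R j i * y j * μ) := fun j => by
    by_cases hj : j < i
    · obtain ⟨μ, hμ, h⟩ := RelErr.exists_of_isFl hu (hp j hj)
      exact ⟨μ, hμ, fun _ => h⟩
    · exact ⟨1, .one hu0 hu 1, fun h => absurd h hj⟩
  choose μ hμ hpμ using hp'
  have hcard : (Finset.Iic i).card ≤ n := by simp
  -- Dividing by `ρ i` leaves `a i` exact and moves all errors onto the entries of `R`, at most `2n`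
  -- factors each.
  set θ : Fin n → ℝ := fun j => (if j = i then ν⁻¹ else μ j * ρ j) * (ρ i)⁻¹ with hθ
  have hn := i.pos
  have hθerr : ∀ j ∈ Finset.univ, RelErr u (2 * n) (θ j) := fun j _ => by
    rw [hθ]
    dsimp only
    split_ifs
    · exact ((hν.inv hu).mul hu ((hρ i).inv hu)).mono hu0 hu (by omega)
    · exact (((hμ j).mul hu (hρ j)).mul hu ((hρ i).inv hu)).mono hu0 hu (by omega)
  have ha : a i = ∑ j, y j * R j i * θ j := by
    have hρi := ((hρ i).pos hu).ne'
    have hνi := (hν.pos hu).ne'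
    have hRi := hd i
    have ht' : t = a i * ρ i - ∑ j ∈ Finset.Iio i, y j * R j i * (μ j * ρ j) := by
      rw [ht, ← Finset.Iio_insert, Finset.sum_insert (by simp), if_pos rfl, sub_eq_add_neg,
        ← Finset.sum_neg_distrib]
      congr 1
      refine Finset.sum_congr rfl fun j hj => ?_
      have hj := Finset.mem_Iio.1 hj
      rw [if_neg hj.ne, hpμ j hj]
      ring
    have hyR : y i * R i i * ν⁻¹ = t := by
      rw [hy]; field_simp
    have hsub : ∑ j, y j * R j i * θ j = ∑ j ∈ Finset.Iic i, y j * R j i * θ j :=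
      (Finset.sum_subset (Finset.subset_univ _) fun j _ hj => by
        rw [hR j i (not_le.1 fun h => hj (Finset.mem_Iic.2 h)), mul_zero, zero_mul]).symm
    have hlow : ∑ j ∈ Finset.Iio i, y j * R j i * θ j =
        (∑ j ∈ Finset.Iio i, y j * R j i * (μ j * ρ j)) * (ρ i)⁻¹ := by
      rw [Finset.sum_mul]
      refine Finset.sum_congr rfl fun j hj => ?_
      simp only [hθ, if_neg (Finset.mem_Iio.1 hj).ne]
      ring
    rw [hsub, ← Finset.Iio_insert, Finset.sum_insert (by simp), hlow]
    simp only [hθ, if_true]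
    rw [← mul_assoc, hyR, ← add_mul, ht', sub_add_cancel, mul_assoc, mul_inv_cancel₀ hρi, mul_one]
  rw [ha]
  simpa only [abs_mul] using abs_sum_mul_relErr_sub_le hu hk Finset.univ
    (a := fun j => y j * R j i) hθerr

theorem FlRightSolve.specNorm_residual_le {m n : ℕ} {u : ℝ} (hu0 : 0 ≤ u) (hu : u < 1)
    (hk : ((2 * n : ℕ) : ℝ) * u < 1) {A Y : Matrix (Fin m) (Fin n) ℝ}
    {R : Matrix (Fin n) (Fin n) ℝ} (hR : ∀ i j, j < i → R i j = 0) (hd : ∀ i, R i i ≠ 0)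
    (h : FlRightSolve u A R Y) :
    specNorm (A - Y * R) ≤ gam u (2 * n) * n * (specNorm Y * specNorm R) := by
  have hg := gam_nonneg hu0 hk
  have hE : ∀ i j, |(A - Y * R) i j| ≤ gam u (2 * n) * ∑ k, |Y i k| * |R k j| := fun i j =>
    (h i).abs_residual_le hu0 hu hk hR hd j
  refine (specNorm_le_fro _).trans ((fro_le_of_entry_le_abs_mul hg hE).trans ?_)
  have := mul_le_mul (fro_le_sqrt_mul_specNorm Y) (fro_le_sqrt_mul_specNorm R)
    (fro_nonneg _) (mul_nonneg (Real.sqrt_nonneg _) (specNorm_nonneg _))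
  refine (mul_le_mul_of_nonneg_left this hg).trans_eq ?_
  have hs := Real.mul_self_sqrt (Nat.cast_nonneg (α := ℝ) n)
  linear_combination gam u (2 * n) * specNorm Y * specNorm R * hs

/-! ### Conditioning of the preconditioned matrix -/

section conditioning

variable {m s n : ℕ}

theorem diag_ne_zero_of_injective {R : Matrix (Fin n) (Fin n) ℝ} (hR : ∀ i j, j < i → R i j = 0)
    (hinj : Function.Injective R.mulVec) (i : Fin n) : R i i ≠ 0 := by
  have hu := (Matrix.isUnit_iff_isUnit_det _).1 (Matrix.mulVec_injective_iff_isUnit.1 hinj)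
  rw [Matrix.det_of_isUpperTriangular fun i j hij => hR i j hij] at hu
  exact Finset.prod_ne_zero_iff.1 hu.ne_zero i (Finset.mem_univ i)

theorem pos_of_one_le_mul {a b : ℝ} (ha : 0 ≤ a) (hb : 0 ≤ b) (h : 1 ≤ a * b) : 0 < a ∧ 0 < b := by
  constructor
  · refine ha.lt_of_ne' fun h0 => ?_
    rw [h0, zero_mul] at h; linarith
  · refine hb.lt_of_ne' fun h0 => ?_
    rw [h0, mul_zero] at h; linarith

theorem cond2_le_kS (S : Matrix (Fin s) (Fin m) ℝ) {QA : Matrix (Fin m) (Fin n) ℝ}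
    (hQ : QAᵀ * QA = 1) : cond2 (S * QA) ≤ kS S QA := by
  refine mul_le_mul_of_nonneg_right (specNorm_le (specNorm_nonneg _) fun x => ?_)
    (specNorm_nonneg _)
  rw [← Matrix.mulVec_mulVec, ← en_mulVec_of_transpose_mul_self hQ x]
  exact en_mulVec_le _ _

/-- A triangular factor of a small perturbation of `S A` acts like `A`, up to the conditioning of
`S Q_A`. -/
theorem triangular_factor_bounds {A QA : Matrix (Fin m) (Fin n) ℝ} {S : Matrix (Fin s) (Fin m) ℝ}
    {RA R : Matrix (Fin n) (Fin n) ℝ} {C : ℝ} (hn : 0 < n) (hC : 0 ≤ C)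
    (hA : LinearIndependent ℝ A.col) (hSQ : LinearIndependent ℝ (S * QA).col)
    (hAQR : A = QA * RA) (hQ : QAᵀ * QA = 1)
    (hCk : 3 * (C * kS S QA * cond2 A) ≤ 1)
    (hR : ∀ x, |en (R *ᵥ x) - en ((S * A) *ᵥ x)| ≤ C * (specNorm S * specNorm A) * en x)
    (x : Fin n → ℝ) :
    2 * en (A *ᵥ x) ≤ 3 * specNorm (pinv (S * QA)) * en (R *ᵥ x) ∧
      3 * specNorm (pinv (S * QA)) * en (R *ᵥ x) ≤ (3 * cond2 (S * QA) + 1) * en (A *ᵥ x) := by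
  obtain ⟨-, hg⟩ := pos_of_one_le_mul (specNorm_nonneg _) (specNorm_nonneg _) (one_le_cond2 hn hSQ)
  have hAx : en (A *ᵥ x) = en (RA *ᵥ x) := by
    rw [hAQR, ← Matrix.mulVec_mulVec, en_mulVec_of_transpose_mul_self hQ]
  have hSAx : (S * A) *ᵥ x = (S * QA) *ᵥ (RA *ᵥ x) := by
    rw [hAQR, ← Matrix.mul_assoc, Matrix.mulVec_mulVec]
  have hup := en_mulVec_le (S * QA) (RA *ᵥ x)
  have hlow := en_le_specNorm_pinv_mul hSQ (RA *ᵥ x)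
  have hx := en_le_specNorm_pinv_mul hA x
  have hRx := abs_le.1 (hR x)
  rw [hSAx] at hRx
  rw [hAx] at hx ⊢
  set g := specNorm (pinv (S * QA))
  set z := en (RA *ᵥ x)
  have hz : 0 ≤ z := en_nonneg _
  -- The perturbation is at most a third of the lower bound `z / g` for `‖S A x‖`.
  have hpert : 3 * g * (C * (specNorm S * specNorm A) * en x) ≤ z := by
    have h1 : 0 ≤ 3 * g * (C * (specNorm S * specNorm A)) := by
      have := specNorm_nonneg S
      have := specNorm_nonneg A
      positivity
    calc 3 * g * (C * (specNorm S * specNorm A) * en x)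
        = 3 * g * (C * (specNorm S * specNorm A)) * en x := by ring
      _ ≤ 3 * g * (C * (specNorm S * specNorm A)) * (specNorm (pinv A) * z) :=
        mul_le_mul_of_nonneg_left hx h1
      _ = 3 * (C * kS S QA * cond2 A) * z := by unfold kS cond2; ring
      _ ≤ z := by nlinarith
  constructor
  · nlinarith [mul_le_mul_of_nonneg_left hRx.1 hg.le]
  · have h2 : g * en ((S * QA) *ᵥ RA *ᵥ x) ≤ cond2 (S * QA) * z := by
      refine (mul_le_mul_of_nonneg_left hup hg.le).trans_eq ?_
      unfold cond2; ring
    nlinarith [mul_le_mul_of_nonneg_left hRx.2 hg.le]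

/-- Conditioning of an approximate solution `Y` of `Y R = A`, where `‖R x‖` is comparable to
`‖A x‖`: up to scaling by `g`, the ratio lies between `2 / 3` and `κ + 1 / 3`. -/
theorem cond2_approx_solution_le {A Y : Matrix (Fin m) (Fin n) ℝ} {R : Matrix (Fin n) (Fin n) ℝ}
    {g κ η : ℝ} (hg : 0 < g) (hκ1 : 1 ≤ κ) (hκ : κ < 49) (hη : 0 ≤ η)
    (hA : LinearIndependent ℝ A.col) (hinj : Function.Injective R.mulVec)
    (hlow : ∀ x, 2 * en (A *ᵥ x) ≤ 3 * g * en (R *ᵥ x))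
    (hup : ∀ x, 3 * g * en (R *ᵥ x) ≤ (3 * κ + 1) * en (A *ᵥ x))
    (hres : specNorm (A - Y * R) ≤ η * (specNorm Y * specNorm R))
    (hsmall : 1000 * (2 * η * κ * cond2 A) ≤ 1) :
    LinearIndependent ℝ Y.col ∧ cond2 Y ≤ 4 * κ + 1 := by
  -- Uses `3κ + 1 ≤ 4κ`.
  have hR : 3 * g * specNorm R ≤ 4 * κ * specNorm A := by
    rw [← le_div_iff₀' (by positivity)]
    refine specNorm_le (div_nonneg (mul_nonneg (by linarith) (specNorm_nonneg _)) (by positivity))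
      fun x => ?_
    rw [div_mul_eq_mul_div, le_div_iff₀' (by positivity)]
    refine (hup x).trans ?_
    have := en_mulVec_le A x
    have := en_nonneg (A *ᵥ x)
    nlinarith
  have hy0 := specNorm_nonneg Y
  have hdiff : ∀ x, 1000 * en (A *ᵥ x - Y *ᵥ (R *ᵥ x)) ≤ specNorm Y * en (R *ᵥ x) := fun x => by
    have h1 := en_mulVec_le (A - Y * R) x
    rw [Matrix.sub_mulVec, ← Matrix.mulVec_mulVec] at h1
    have h2 : 2 * en x ≤ specNorm (pinv A) * (3 * g * en (R *ᵥ x)) := by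
      have h3 := en_le_specNorm_pinv_mul hA x
      have h4 := mul_le_mul_of_nonneg_left (hlow x) (specNorm_nonneg (pinv A))
      linarith
    have hw := en_nonneg (R *ᵥ x)
    have h5 : specNorm R * (2 * en x) ≤ 4 * (κ * cond2 A) * en (R *ᵥ x) := by
      calc specNorm R * (2 * en x)
          ≤ specNorm R * (specNorm (pinv A) * (3 * g * en (R *ᵥ x))) :=
            mul_le_mul_of_nonneg_left h2 (specNorm_nonneg _)
        _ = 3 * g * specNorm R * (specNorm (pinv A) * en (R *ᵥ x)) := by ring
        _ ≤ 4 * κ * specNorm A * (specNorm (pinv A) * en (R *ᵥ x)) :=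
            mul_le_mul_of_nonneg_right hR (mul_nonneg (specNorm_nonneg _) hw)
        _ = _ := by unfold cond2; ring
    calc 1000 * en (A *ᵥ x - Y *ᵥ (R *ᵥ x))
        ≤ 1000 * (η * (specNorm Y * specNorm R) * en x) := by
          have := mul_le_mul_of_nonneg_right hres (en_nonneg x)
          linarith
      _ = 500 * η * specNorm Y * (specNorm R * (2 * en x)) := by ring
      _ ≤ 500 * η * specNorm Y * (4 * (κ * cond2 A) * en (R *ᵥ x)) :=
          mul_le_mul_of_nonneg_left h5 (by positivity)
      _ = 1000 * (2 * η * κ * cond2 A) * (specNorm Y * en (R *ᵥ x)) := by ring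
      _ ≤ specNorm Y * en (R *ᵥ x) := by nlinarith [mul_nonneg hy0 hw]
  have hsurj : ∀ w, ∃ x, R *ᵥ x = w := fun w => by
    have hu := (Matrix.isUnit_iff_isUnit_det _).1 (Matrix.mulVec_injective_iff_isUnit.1 hinj)
    exact ⟨R⁻¹ *ᵥ w, by rw [Matrix.mulVec_mulVec, Matrix.mul_nonsing_inv _ hu, Matrix.one_mulVec]⟩
  -- The residual bound involves `‖Y‖` itself; absorbing it gives `‖Y‖ ≤ (500/333) g`.
  have hY : specNorm Y ≤ 3 / 2 * g + specNorm Y / 1000 := by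
    refine specNorm_le (by positivity) fun w => ?_
    obtain ⟨x, rfl⟩ := hsurj w
    have h1 := en_le_en_add_sub (Y *ᵥ (R *ᵥ x)) (A *ᵥ x)
    rw [en_sub_comm] at h1
    linarith [hlow x, hdiff x]
  -- `27/10 = 3 - 3/10`: since `κ < 49`, one has `3κ + 1 ≤ 148`, and the residual costs at most `148
  -- · (500/333) / 1000 < 3/10`.
  have hμ : 0 < 27 / 10 * g / (3 * κ + 1) := by positivity
  have hYlow : ∀ w, 27 / 10 * g / (3 * κ + 1) * en w ≤ en (Y *ᵥ w) := fun w => by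
    obtain ⟨x, rfl⟩ := hsurj w
    have h1 := en_le_en_add_sub (A *ᵥ x) (Y *ᵥ (R *ᵥ x))
    have hw := en_nonneg (R *ᵥ x)
    have h2 : 1000 * en (A *ᵥ x - Y *ᵥ (R *ᵥ x)) ≤ 500 / 333 * g * en (R *ᵥ x) :=
      (hdiff x).trans (mul_le_mul_of_nonneg_right (by linarith) hw)
    have h3 := hup x
    rw [div_mul_eq_mul_div, div_le_iff₀ (by positivity)]
    have h4 : (3 * κ + 1) * en (A *ᵥ x - Y *ᵥ (R *ᵥ x)) ≤ 3 / 10 * g * en (R *ᵥ x) := by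
      have : (3 * κ + 1) * en (A *ᵥ x - Y *ᵥ (R *ᵥ x)) ≤ 148 * en (A *ᵥ x - Y *ᵥ (R *ᵥ x)) :=
        mul_le_mul_of_nonneg_right (by linarith) (en_nonneg _)
      nlinarith [mul_nonneg hg.le hw]
    nlinarith
  refine ⟨linearIndependent_col_of_le_en hμ hYlow, ?_⟩
  have h1 := specNorm_pinv_le hμ hYlow
  calc cond2 Y ≤ 500 / 333 * g * (1 / (27 / 10 * g / (3 * κ + 1))) :=
        mul_le_mul (by linarith) h1 (specNorm_nonneg _) (by positivity)
    _ = 5000 / 8991 * (3 * κ + 1) := by field_simp; norm_num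
    _ ≤ 4 * κ + 1 := by linarith

end conditioning

/-! ### The error constant -/

/-- `γ_k ≤ 1/3` means `k u ≤ 1/4`, so the denominator is at least `3/4`. -/
theorem gam_le_of_le_third {u : ℝ} (hu : 0 ≤ u) {k : ℕ} (hk : k * u < 1) (h : gam u k ≤ 1 / 3) :
    gam u k ≤ 4 / 3 * (k * u) := by
  have h0 : 0 ≤ k * u := by positivity
  have hpos : 0 < 1 - k * u := by linarith
  unfold gam at h ⊢
  rw [div_le_iff₀ hpos] at h ⊢
  nlinarith

theorem le_gam {u : ℝ} (hu : 0 ≤ u) {k : ℕ} (hk : k * u < 1) : k * u ≤ gam u k := by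
  have h0 : 0 ≤ k * u := by positivity
  unfold gam
  rw [le_div_iff₀ (by linarith)]
  nlinarith

theorem C1_nonneg {c m s n : ℕ} {u : ℝ} (hu : 0 ≤ u) (hm : m * u < 1)
    (hc : ((c * s * n : ℕ) : ℝ) * u < 1) : 0 ≤ C1 c u m s n := by
  have := gam_nonneg hu hm
  have := gam_nonneg hu hc
  unfold C1
  positivity

theorem sqrt_mul_gam_le_C1 {c m s n : ℕ} {u : ℝ} (hu : 0 ≤ u) (hm : m * u < 1)
    (hc : ((c * s * n : ℕ) : ℝ) * u < 1) : √(n : ℝ) * gam u (c * s * n) ≤ C1 c u m s n := by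
  have h1 := gam_nonneg hu hm
  have h2 := gam_nonneg hu hc
  have h3 : 0 ≤ √((s : ℝ) * n) * gam u m := by positivity
  have h4 : 0 ≤ √(n : ℝ) * gam u (c * s * n) := by positivity
  unfold C1
  nlinarith

theorem C1_le {c m s n : ℕ} {u : ℝ} (hs : 0 < s) (hn : 0 < n) (hc0 : 0 < c) (hu : 0 ≤ u)
    (hm : m * u < 1) (hc : ((c * s * n : ℕ) : ℝ) * u < 1) (h : C1 c u m s n ≤ 1 / 3) :
    C1 c u m s n ≤ 2 * c * ((√((s : ℝ) * n) * m + s * (n : ℝ) ^ (3 / 2 : ℝ)) * u) := by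
  have hs1 : (1 : ℝ) ≤ s := by exact_mod_cast hs
  have hn1 : (1 : ℝ) ≤ n := by exact_mod_cast hn
  have hc1 : (1 : ℝ) ≤ c := by exact_mod_cast hc0
  have hg1 := gam_nonneg hu hm
  have hg2 := gam_nonneg hu hc
  have hr1 : 1 ≤ √((s : ℝ) * n) := Real.one_le_sqrt.2 (by nlinarith)
  have hr2 : 1 ≤ √(n : ℝ) := Real.one_le_sqrt.2 hn1
  have hfst : √((s : ℝ) * n) * gam u m ≤ 1 / 3 := by
    have : 0 ≤ √(n : ℝ) * gam u (c * s * n) * (1 + √((s : ℝ) * n) * gam u m) := by positivity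
    unfold C1 at h
    linarith
  have hsnd := (sqrt_mul_gam_le_C1 hu hm hc).trans h
  have h1 := gam_le_of_le_third hu hm (by nlinarith)
  have h2 := gam_le_of_le_third hu hc (by nlinarith)
  have hpow : (n : ℝ) ^ (3 / 2 : ℝ) = n * √(n : ℝ) := by
    rw [Real.sqrt_eq_rpow, show (3 / 2 : ℝ) = 1 + 1 / 2 by norm_num,
      Real.rpow_add (by linarith), Real.rpow_one]
  push_cast at h2
  have h3 : √(n : ℝ) * gam u (c * s * n) ≤ √(n : ℝ) * (4 / 3 * (c * s * n * u)) := by gcongr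
  have h4 : √((s : ℝ) * n) * gam u m ≤ √((s : ℝ) * n) * (4 / 3 * (m * u)) := by gcongr
  have h5 : √(n : ℝ) * gam u (c * s * n) * (1 + √((s : ℝ) * n) * gam u m) ≤
      √(n : ℝ) * (4 / 3 * (c * s * n * u)) * (4 / 3) :=
    mul_le_mul h3 (by linarith) (by positivity) (by positivity)
  have h6 : 0 ≤ √((s : ℝ) * n) * (m * u) := by positivity
  have h7 : 0 ≤ √(n : ℝ) * (c * s * n * u) := by positivity
  rw [hpow]
  unfold C1
  nlinarith

/-- The computed triangular factor, as a perturbation of `S A`. -/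
theorem abs_en_triangular_sub_le {c m s n : ℕ} {u : ℝ} (hc34 : 34 ≤ c) (hs : 2 ≤ s) (hu0 : 0 ≤ u)
    (hu : u < 1) (hm : m * u < 1) (hc : ((c * s * n : ℕ) : ℝ) * u < 1) (hsu : 500 * s * u ≤ 1)
    {hns : n ≤ s} {A : Matrix (Fin m) (Fin n) ℝ} {S : Matrix (Fin s) (Fin m) ℝ}
    {B : Matrix (Fin s) (Fin n) ℝ} {R : Matrix (Fin n) (Fin n) ℝ}
    (hB : FlMul u S A B) (hR : FlHouseholderR u hns B R) :
    (∀ i j, j < i → R i j = 0) ∧ ∀ x, |en (R *ᵥ x) - en ((S * A) *ᵥ x)| ≤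
      C1 c u m s n * (specNorm S * specNorm A) * en x := by
  obtain ⟨htri, V, Q, hV, hQ, hE⟩ := hR.exists_perturbation hc34 hs hu0 hu hsu hc
  refine ⟨htri, fun x => ?_⟩
  have hBE := hB.specNorm_sub_le hu0 hu hm
  have hg := gam_nonneg hu0 hc
  have hBn : specNorm B ≤ (1 + √((s : ℝ) * n) * gam u m) * (specNorm S * specNorm A) := by
    have h1 := specNorm_add_le (B - S * A) (S * A)
    rw [sub_add_cancel] at h1
    have h2 := specNorm_mul_le S A
    linarith
  have hx := en_nonneg x
  have h1 : en (V *ᵥ x - Q *ᵥ (B *ᵥ x)) ≤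
      √(n : ℝ) * gam u (c * s * n) * ((1 + √((s : ℝ) * n) * gam u m) *
        (specNorm S * specNorm A)) * en x := by
    have := en_mulVec_le (V - Q * B) x
    rw [Matrix.sub_mulVec, ← Matrix.mulVec_mulVec] at this
    exact this.trans (mul_le_mul_of_nonneg_right
      (hE.trans (mul_le_mul_of_nonneg_left hBn (by positivity))) hx)
  have h2 : en (B *ᵥ x - (S * A) *ᵥ x) ≤
      √((s : ℝ) * n) * gam u m * (specNorm S * specNorm A) * en x := by
    rw [← Matrix.sub_mulVec]
    exact (en_mulVec_le _ x).trans (mul_le_mul_of_nonneg_right hBE hx)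
  have h3 := en_le_en_add_sub (V *ᵥ x) (Q *ᵥ (B *ᵥ x))
  have h4 := en_le_en_add_sub (Q *ᵥ (B *ᵥ x)) (V *ᵥ x)
  have h5 := en_le_en_add_sub (B *ᵥ x) ((S * A) *ᵥ x)
  have h6 := en_le_en_add_sub ((S * A) *ᵥ x) (B *ᵥ x)
  rw [en_sub_comm] at h4 h6
  rw [hQ] at h3 h4
  rw [hV, abs_le]
  unfold C1
  constructor <;> linarith

end SketchApply

/-! ### Choice of constants and assembly of the theorem. -/

open SketchApply in
theorem mainTheorem1 :
    ∃ (c : ℕ) (K : ℝ), 0 < c ∧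
      ∀ (m s n : ℕ) (_hsm : s < m) (hns : n < s) (u : ℝ)
        (A : Matrix (Fin m) (Fin n) ℝ) (S : Matrix (Fin s) (Fin m) ℝ)
        (QA : Matrix (Fin m) (Fin n) ℝ) (RA : Matrix (Fin n) (Fin n) ℝ)
        (Bhat : Matrix (Fin s) (Fin n) ℝ) (Rhat : Matrix (Fin n) (Fin n) ℝ)
        (Yhat : Matrix (Fin m) (Fin n) ℝ),
        -- the unit round-off, for which `γ_m` and `γ̃_{sn}` make sense
        0 < u → (m : ℝ) * u < 1 → (c : ℝ) * s * n * u < 1 →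
        -- `A` and `SA` have full column rank, `S` has full row rank
        LinearIndependent ℝ A.col →
        LinearIndependent ℝ S.row →
        LinearIndependent ℝ (S * A).col →
        -- economized QR factorization `A = Q_A R_A`
        A = QA * RA → QA.transpose * QA = 1 → RA.BlockTriangular id →
        -- quantitative assumptions
        cond2 (S * QA) < 49 →
        (n : ℝ) ^ 2 * u < 1 / 201 →
        (m : ℝ) / n + √(n : ℝ) > 200 →
        cond2 A < 1 / (3 * C1 c u m s n * kS S QA) →
        -- the three steps in floating point
        FlMul u S A Bhat →
        FlHouseholderR u hns.le Bhat Rhat →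
        FlRightSolve u A Rhat Yhat →
        C1 c u m s n ≤ K * ((√((s : ℝ) * n) * m + s * (n : ℝ) ^ (3 / 2 : ℝ)) * u) ∧
        (∀ i, Rhat i i ≠ 0) ∧
        LinearIndependent ℝ Yhat.col ∧
        cond2 Yhat ≤ 4 * cond2 (S * QA) + 1 := by
  -- `3000 = 3 · 1000`: `n γ_{2n} ≤ 3 n² u` must be at most `C₁ / 1000`, and `C₁ ≥ c n² u`.
  refine ⟨3000, 2 * (3000 : ℕ), by norm_num, ?_⟩
  intro m s n hsm hns u A S QA RA B R Y hu0 hm hc hA _ hSA hAQR hQ _ hκ _ hmn hcond hB hR hY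
  have hn : 0 < n := by
    -- For `n = 0` the quotient `m / n` is `0` by convention, contradicting `hmn`.
    rcases n.eq_zero_or_pos with rfl | h
    · norm_num at hmn
    · exact h
  have hn1 : (1 : ℝ) ≤ n := by exact_mod_cast hn
  have hns' : (n : ℝ) ≤ s := by exact_mod_cast hns.le
  have hm1 : (1 : ℝ) ≤ m := by exact_mod_cast (show 1 ≤ m by omega)
  have hu : u < 1 := by nlinarith
  have hc' : ((3000 * s * n : ℕ) : ℝ) * u < 1 := by push_cast at hc ⊢; exact hc
  have hc0 : 3000 * (s * n * u) < 1 := by push_cast at hc; linarith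
  have hsu : (s : ℝ) * u ≤ s * n * u := by
    have : 0 ≤ (s : ℝ) * u := by positivity
    nlinarith
  have hnu : (n : ℝ) * u ≤ s * u := mul_le_mul_of_nonneg_right hns' hu0.le
  -- injectivity of the factors
  have hSQ : LinearIndependent ℝ (S * QA).col := by
    have hRA : IsUnit RA := by
      rw [← Matrix.mulVec_injective_iff_isUnit]
      have := Matrix.mulVec_injective_iff.2 hA
      intro x y hxy
      apply this
      rw [hAQR, ← Matrix.mulVec_mulVec, ← Matrix.mulVec_mulVec]
      exact congrArg _ hxy
    have hdet := (Matrix.isUnit_iff_isUnit_det _).1 hRA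
    have hinj := Matrix.mulVec_injective_iff.2 hSA
    rw [← Matrix.mulVec_injective_iff]
    have hSQ' : S * QA = S * A * RA⁻¹ := by
      rw [hAQR, Matrix.mul_assoc, Matrix.mul_assoc, Matrix.mul_nonsing_inv _ hdet, Matrix.mul_one]
    have hinv : IsUnit RA⁻¹ := (Matrix.isUnit_nonsing_inv_iff).2 hRA
    intro x y hxy
    rw [hSQ', ← Matrix.mulVec_mulVec x (S * A), ← Matrix.mulVec_mulVec y (S * A)] at hxy
    exact Matrix.mulVec_injective_iff_isUnit.2 hinv (hinj hxy)
  -- the size of the perturbation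
  have hκ1 := one_le_cond2 hn hSQ
  have hκA := one_le_cond2 hn hA
  have hkS := cond2_le_kS S hQ
  have hC0 := C1_nonneg (s := s) hu0.le hm hc'
  have hCk : 3 * (C1 3000 u m s n * kS S QA * cond2 A) < 1 := by
    -- Otherwise the quotient in `hcond` would be at most `0`, while `κ₂(A) ≥ 1`.
    have hpos : 0 < 3 * C1 3000 u m s n * kS S QA := by
      by_contra hneg
      have := div_nonpos_of_nonneg_of_nonpos zero_le_one (not_lt.1 hneg)
      linarith
    rw [lt_div_iff₀ hpos] at hcond
    linarith
  have hk1 : 1 ≤ kS S QA * cond2 A := by nlinarith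
  have hC : C1 3000 u m s n ≤ 1 / 3 := by nlinarith
  obtain ⟨htri, hpert⟩ := abs_en_triangular_sub_le (c := 3000) (by norm_num) (by omega) hu0.le hu hm
    hc' (by linarith) hB hR
  have hbounds := triangular_factor_bounds hn hC0 hA hSQ hAQR hQ hCk.le hpert
  obtain ⟨-, hg⟩ := pos_of_one_le_mul (specNorm_nonneg _) (specNorm_nonneg _) hκ1
  have hinj : Function.Injective R.mulVec := by
    intro x y hxy
    apply Matrix.mulVec_injective_iff.2 hA
    have h1 := (hbounds (x - y)).1
    rw [Matrix.mulVec_sub R, sub_eq_zero.2 hxy, en_zero, mul_zero] at h1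
    have h2 : en (A *ᵥ (x - y)) = 0 := le_antisymm (by linarith) (en_nonneg _)
    rw [en_eq_zero, Matrix.mulVec_sub] at h2
    exact sub_eq_zero.1 h2
  have hdiag := diag_ne_zero_of_injective htri hinj
  have h2n : ((2 * n : ℕ) : ℝ) * u < 1 := by push_cast; linarith
  have hres := hY.specNorm_residual_le hu0.le hu h2n htri hdiag
  have hγ : gam u (2 * n) * n ≤ 3 * (n * (n * u)) := by
    have : gam u (2 * n) ≤ 3 * (n * u) := by
      unfold gam
      push_cast at h2n ⊢
      have : 0 ≤ (n : ℝ) * u := by positivity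
      rw [div_le_iff₀ (by linarith)]
      nlinarith
    calc gam u (2 * n) * n ≤ 3 * (n * u) * n := by gcongr
      _ = _ := by ring
  have hCn : 3000 * (n * (n * u)) ≤ C1 3000 u m s n := by
    have h1 := sqrt_mul_gam_le_C1 (s := s) hu0.le hm hc'
    have h2 := le_gam hu0.le hc'
    have h3 : 1 ≤ √(n : ℝ) := Real.one_le_sqrt.2 hn1
    have h4 : (n : ℝ) * (n * u) ≤ n * (s * u) := by gcongr
    have h5 := gam_nonneg hu0.le hc'
    push_cast at h2
    nlinarith
  have hη0 := mul_nonneg (gam_nonneg hu0.le h2n) (Nat.cast_nonneg (α := ℝ) n)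
  -- The left side is at most `2 C₁ k(S) κ₂(A) < 2/3`.
  have hsmall : 1000 * (2 * (gam u (2 * n) * n) * cond2 (S * QA) * cond2 A) ≤ 1 := by
    have h1 : cond2 (S * QA) * cond2 A ≤ kS S QA * cond2 A := by gcongr
    have h2 : gam u (2 * n) * n * (cond2 (S * QA) * cond2 A) ≤
        C1 3000 u m s n / 1000 * (kS S QA * cond2 A) :=
      mul_le_mul (by linarith) h1 (mul_nonneg (by linarith) (by linarith)) (by linarith)
    linarith
  have hC1 := C1_le (c := 3000) (s := s) (by omega) hn (by norm_num) hu0.le hm hc' hC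
  exact ⟨hC1, hdiag,
    cond2_approx_solution_le hg hκ1 hκ hη0 hA hinj (fun x => (hbounds x).1)
      (fun x => (hbounds x).2) hres hsmall⟩
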